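/- Let $n\ge 2$ and $\alpha\in(0,1)$. Let $\mathcal F u(\xi)=(2\pi)^{-n/2}\int_{\mathbb R^n}u(x)e^{-i\xi\cdot x}\,dx$ be the Fourier transform, extended to $L^2(\mathbb R^n)$. For $u\in L^2(\mathbb R^n;\mathbb C)$ the Riesz fractional gradient $D^\alpha u$ ($\mathbb C^n$-valued) and the fractional Laplacian $(-\Delta)^{\alpha/2}u$ are defined through $$\mathcal F(D^\alpha u)(\xi)=\frac{\xi}{|\xi|^{1-\alpha}}\,\mathcal F u(\xi),\qquad \mathcal F((-\Delta)^{\alpha/2}u)(\xi)=|\xi|^\alpha\,\mathcal F u(\xi),$$ and $H^{\alpha,2}(\mathbb R^n)$ is the space of all $u\in L^2(\mathbb R^n;\mathbb C)$ with $|D^\alpha u|\in L^2(\mathbb R^n)$; for such $u$ also $(-\Delta)^{\alpha/2}u\in L^2(\mathbb R^n)$. For a ball $B=B(x,r)$ with $r>0$ write $\lambda B=B(x,\lambda r)$, and let $\langle f\rangle_B=\frac1{|B|}\int_B f(y)\,dy$ denote the average of $f$ over $B$. There is a constant $C=C(n,\alpha)$ such that for every $u\in H^{\alpha,2}(\mathbb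 R^n)$ and every ball $B\subset\mathbb R^n$ the series below converges and $$\Big(\big\langle|(-\Delta)^{\alpha/2}u|^2\big\rangle_{B}\Big)^{1/2}\le C\bigg(\Big(\big\langle|D^\alpha u|^2\big\rangle_{2B}\Big)^{1/2}+\big\langle|(-\Delta)^{\alpha/2}u|\big\rangle_{B}+\sum_{k=1}^\infty 2^{-k}\big\langle|D^\alpha u|\big\rangle_{2^kB}\bigg).$$ -/

import Mathlib

open MeasureTheory FourierTransform

noncomputable section

namespace LocalRiesz

/-- `ℝⁿ` with the Euclidean norm and Lebesgue measure. -/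
abbrev RSpace (n : ℕ) : Type := EuclideanSpace ℝ (Fin n)

/-- `ℂⁿ` with its Hermitian norm. -/
abbrev CSpace (n : ℕ) : Type := EuclideanSpace ℂ (Fin n)

/-- `L²(ℝⁿ; V)`. -/
abbrev L2 (n : ℕ) (V : Type) [NormedAddCommGroup V] : Type :=
  Lp V 2 (volume : Measure (RSpace n))

/-- `w ∈ L²(ℝⁿ; V)` arises from the scalar function `u ∈ L²(ℝⁿ)` through the `V`-valued Fourier
symbol `m`. The symbol is written in the angular frequency `η`, that is, with respect to the
unitary transform `(2π)^(-n/2) ∫ u(x) exp(-i η·x) dx`. The transform `𝓕` of Mathlib (extended to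
`L²` by Plancherel) has the kernel `exp(-2πi ξ·x)`, hence `η = 2πξ`. -/
def HasSymbol {n : ℕ} {V : Type} [NormedAddCommGroup V] [InnerProductSpace ℂ V] [CompleteSpace V]
    (m : RSpace n → V) (u : L2 n ℂ) (w : L2 n V) : Prop :=
  (fun ξ => (𝓕 w : L2 n V) ξ) =ᵐ[volume]
    fun ξ => ((𝓕 u : L2 n ℂ) ξ) • m ((2 * Real.pi) • ξ)

/-- The symbol `η / |η|^(1-α)` of the Riesz fractional gradient `D^α`. -/
def gradSymbol {n : ℕ} (α : ℝ) (η : RSpace n) : CSpace n :=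
  WithLp.toLp 2 fun j => ((η j / ‖η‖ ^ (1 - α) : ℝ) : ℂ)

/-- The symbol `|η|^α` of the fractional Laplacian `(-Δ)^(α/2)`. -/
def laplaceSymbol {n : ℕ} (α : ℝ) (η : RSpace n) : ℂ := ((‖η‖ ^ α : ℝ) : ℂ)

/-- `u ∈ H^{α,2}(ℝⁿ)`: `u ∈ L²` and `D^α u ∈ L²`. -/
def MemH {n : ℕ} (α : ℝ) (u : L2 n ℂ) : Prop :=
  ∃ w : L2 n (CSpace n), HasSymbol (gradSymbol α) u w

/-- An `L²` function is determined by its symbol relation to `u`; so the functions chosen in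
`rieszGradient` and `fracLaplacian` are the only ones. -/
theorem HasSymbol.unique {n : ℕ} {V : Type} [NormedAddCommGroup V] [InnerProductSpace ℂ V]
    [CompleteSpace V] {m : RSpace n → V} {u : L2 n ℂ} {w w' : L2 n V}
    (h : HasSymbol m u w) (h' : HasSymbol m u w') : w = w' := by
  have h1 : (𝓕 w : L2 n V) = 𝓕 w' := Lp.ext (h.trans h'.symm)
  have h2 := congrArg (fun f : L2 n V => (𝓕⁻ f : L2 n V)) h1
  simpa using h2

theorem norm_gradSymbol {n : ℕ} {α : ℝ} (hα : 0 < α) (η : RSpace n) :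
    ‖gradSymbol α η‖ = ‖laplaceSymbol α η‖ := by
  have h : gradSymbol α η = ((‖η‖ ^ (1 - α) : ℝ) : ℂ)⁻¹ •
      (WithLp.toLp 2 fun j => ((η j : ℝ) : ℂ) : CSpace n) := by
    ext j
    simp [gradSymbol, div_eq_inv_mul]
  have h2 : ‖(WithLp.toLp 2 fun j => ((η j : ℝ) : ℂ) : CSpace n)‖ = ‖η‖ := by
    simp [EuclideanSpace.norm_eq]
  rw [h, norm_smul, h2, laplaceSymbol, norm_inv, Complex.norm_real, Complex.norm_real,
    Real.norm_of_nonneg (by positivity), Real.norm_of_nonneg (by positivity)]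
  rcases eq_or_ne η 0 with rfl | hη
  · simp [Real.zero_rpow hα.ne']
  · have hp : 0 < ‖η‖ := norm_pos_iff.mpr hη
    rw [Real.rpow_sub hp, Real.rpow_one]
    have := (Real.rpow_pos_of_pos hp α).ne'
    field_simp

/-- For `u ∈ H^{α,2}` the fractional Laplacian `(-Δ)^(α/2) u` is an `L²` function. -/
theorem MemH.exists_fracLaplacian {n : ℕ} {α : ℝ} {u : L2 n ℂ} (hu : MemH α u) (hα : 0 < α) :
    ∃ g : L2 n ℂ, HasSymbol (laplaceSymbol α) u g := by
  obtain ⟨w, hw⟩ := hu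
  have hm : MemLp (fun ξ => ((𝓕 u : L2 n ℂ) ξ) • laplaceSymbol α ((2 * Real.pi) • ξ)) 2
      (volume : Measure (RSpace n)) := by
    refine (Lp.memLp (𝓕 w : L2 n (CSpace n))).congr_norm ?_ ?_
    · refine (Lp.aestronglyMeasurable (𝓕 u : L2 n ℂ)).smul ?_
      have : Measurable fun ξ : RSpace n => laplaceSymbol α ((2 * Real.pi) • ξ) := by
        unfold laplaceSymbol
        fun_prop
      exact this.aestronglyMeasurable
    · filter_upwards [hw] with ξ hξ
      rw [hξ, norm_smul, norm_smul, norm_gradSymbol hα]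
  refine ⟨𝓕⁻ (hm.toLp _), ?_⟩
  have h1 : (𝓕 (𝓕⁻ (hm.toLp _) : L2 n ℂ) : L2 n ℂ) = hm.toLp _ := by simp
  unfold HasSymbol
  rw [h1]
  exact hm.coeFn_toLp

/-- The Riesz fractional gradient `D^α u ∈ L²(ℝⁿ; ℂⁿ)` of `u ∈ H^{α,2}`. -/
def rieszGradient {n : ℕ} {α : ℝ} {u : L2 n ℂ} (hu : MemH α u) : L2 n (CSpace n) :=
  hu.choose

/-- The fractional Laplacian `(-Δ)^(α/2) u ∈ L²(ℝⁿ)` of `u ∈ H^{α,2}`. -/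
def fracLaplacian {n : ℕ} {α : ℝ} {u : L2 n ℂ} (hu : MemH α u) (hα : 0 < α) : L2 n ℂ :=
  (hu.exists_fracLaplacian hα).choose

end LocalRiesz

end

noncomputable section

namespace LocalRiesz

open Filter Topology

/-! Write w = D^α u and g = (-Δ)^{α/2} u. Since ξ/|ξ| · ξ/|ξ|^{1-α} = |ξ|^α, g is the Riesz
transform of w, with multiplier ξ/|ξ| (`isMultiplierImage_rieszSymbol`). The estimate is then of
Calderón–Zygmund type: split w into its restrictions to 2B and to the complement of 2B.

The symbol has norm at most 1, so Plancherel bounds the transform l of the local part by the L²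
average of w on 2B (`average_sq_le_of_isMultiplierImage`). The transform g - l of the far part need
not be small, but it is nearly constant on B: the Riesz kernel has gradient O(|z|^{-n-1}), so the
oscillation is at most M r ∫ |w(y)| |y - x|^{-n-1} dy over the complement of 2B
(`exists_norm_sub_le_of_isMultiplierImage`), and dyadic annuli turn this integral into the series
(`lintegral_dyadic_le`). A function of oscillation at most A is bounded by A plus its mean modulus,
and the mean of |g - l| is at most that of |g| plus that of |l|; this is where the average of |g| on
B enters (`rpow_half_integral_sq_le`).

The singular kernel is never handled directly. One writes ξ/|ξ| = ∫₀^∞ t^{-1/2} ξ e^{-πt|ξ|²} dt and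
truncates to a < t ≤ b. For each t the kernel is the explicit i t^{-n/2-1} z e^{-π|z|²/t}, and its
Lipschitz bound integrates in t to the decay |z|^{-n-1}, uniformly in a and b
(`exists_enorm_fourierInv_truncSymbol_sub_le`). The truncated symbols are bounded by 1 and converge
pointwise, so the bound survives the limit almost everywhere along a subsequence. -/

theorem tendsto_eLpNorm_two_of_dominated {Ω F : Type*} {m : MeasurableSpace Ω} {μ : Measure Ω}
    [NormedAddCommGroup F] {fs : ℕ → Ω → F} {bound : Ω → ℝ}
    (hfs : ∀ k, AEStronglyMeasurable (fs k) μ) (hb : MemLp bound 2 μ)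
    (hle : ∀ k, ∀ᵐ x ∂μ, ‖fs k x‖ ≤ bound x)
    (hlim : ∀ᵐ x ∂μ, Tendsto (fun k => fs k x) atTop (𝓝 0)) :
    Tendsto (fun k => eLpNorm (fs k) 2 μ) atTop (𝓝 0) := by
  have hfin := hb.2
  rw [eLpNorm_lt_top_iff_lintegral_rpow_enorm_lt_top (by norm_num) (by norm_num)] at hfin
  have key : Tendsto (fun k => ∫⁻ x, ‖fs k x‖ₑ ^ (2 : ENNReal).toReal ∂μ) atTop
      (𝓝 (∫⁻ _, 0 ∂μ)) := by
    refine tendsto_lintegral_of_dominated_convergence' _ (fun k => (hfs k).enorm.pow_const _)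
      (fun k => ?_) hfin.ne ?_
    · filter_upwards [hle k] with x hx
      refine ENNReal.rpow_le_rpow ?_ (by norm_num)
      rw [← ofReal_norm, ← ofReal_norm]
      exact ENNReal.ofReal_le_ofReal (hx.trans (Real.le_norm_self _))
    · filter_upwards [hlim] with x hx
      simpa using hx.enorm.ennrpow_const 2
  simp only [eLpNorm_eq_lintegral_rpow_enorm_toReal (p := 2) (by norm_num) (by norm_num)]
  simpa using key.ennrpow_const (1 / (2 : ENNReal).toReal)

/-! ### The Fourier transform on L¹ ∩ L² -/

section FourierL1L2

variable {E F : Type*} [NormedAddCommGroup E] [InnerProductSpace ℝ E] [FiniteDimensional ℝ E]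
  [MeasurableSpace E] [BorelSpace E] [NormedAddCommGroup F] [InnerProductSpace ℂ F]

theorem integral_fourier_smul_eq [CompleteSpace F] {φ : E → ℂ} {f : E → F} (hφ : Integrable φ) (hf : Integrable f) :
    ∫ ξ, 𝓕 φ ξ • f ξ = ∫ x, φ x • 𝓕 f x := by
  simpa using! VectorFourier.integral_fourierIntegral_smul_eq_flip (L := innerₗ E)
    Real.continuous_fourierChar continuous_inner hφ hf

theorem integral_fourierInv_smul_eq [CompleteSpace F] {φ : E → ℂ} {f : E → F} (hφ : Integrable φ)
    (hf : Integrable f) : ∫ ξ, 𝓕⁻ φ ξ • f ξ = ∫ x, φ x • 𝓕⁻ f x := by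
  have h1 : ∀ x, 𝓕⁻ f x = 𝓕 (fun y => f (-y)) x := fun x => by
    rw [Real.fourierInv_eq_fourier_comp_neg]
  have h2 : ∀ x, 𝓕⁻ φ x = 𝓕 φ (-x) := fun x => Real.fourierInv_eq_fourier_neg φ x
  simp only [h1, h2]
  rw [← integral_fourier_smul_eq hφ hf.comp_neg,
    ← integral_neg_eq_self (fun x => 𝓕 φ x • f (-x))]
  simp

theorem continuous_fourier {f : E → F} (hf : Integrable f) : Continuous (𝓕 f) :=
  VectorFourier.fourierIntegral_continuous Real.continuous_fourierChar (L := innerₗ E)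
    continuous_inner hf

theorem norm_fourier_le {f : E → F} (ξ : E) : ‖𝓕 f ξ‖ ≤ ∫ x, ‖f x‖ :=
  VectorFourier.norm_fourierIntegral_le_integral_norm _ _ _ _ _

theorem continuous_fourierInv {f : E → F} (hf : Integrable f) : Continuous (𝓕⁻ f) := by
  have : 𝓕⁻ f = fun x => 𝓕 f (-x) := funext fun x => Real.fourierInv_eq_fourier_neg f x
  rw [this]
  exact (continuous_fourier hf).comp continuous_neg

/-- On `L¹ ∩ L²` the Fourier transform of `L²` is given by the Fourier integral. -/
theorem fourier_toLp_ae_eq [CompleteSpace F] {f : E → F} (h1 : Integrable f) (h2 : MemLp f 2) :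
    ((𝓕 (h2.toLp f) : Lp F 2 (volume : Measure E)) : E → F) =ᵐ[volume] 𝓕 f := by
  -- It suffices to test against smooth compactly supported functions. These are Schwartz, so the L²
  -- transform may be read as that of tempered distributions, and the multiplication formula
  -- finishes.
  refine ae_eq_of_integral_contDiff_smul_eq
    ((Lp.memLp _).locallyIntegrable (by norm_num)) (continuous_fourier h1).locallyIntegrable ?_
  intro g hg hgc
  have hg₁ : HasCompactSupport (Complex.ofRealCLM ∘ g) := hgc.comp_left rfl
  have hg₂ : ContDiff ℝ (⊤ : ℕ∞) (Complex.ofRealCLM ∘ g) := by fun_prop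
  set φ := hg₁.toSchwartzMap hg₂
  have hφ : ∀ x, φ x = (g x : ℂ) := fun x => rfl
  have h := congrArg (fun T => T φ) (Lp.fourier_toTemperedDistribution_eq (h2.toLp f))
  simp only [TemperedDistribution.fourier_apply, Lp.toTemperedDistribution_apply] at h
  calc _ = ∫ x, φ x • (𝓕 (h2.toLp f) : Lp F 2 (volume : Measure E)) x := by
        simp [hφ]
    _ = ∫ x, (𝓕 φ) x • f x := by
        rw [← h]
        refine integral_congr_ae ?_
        filter_upwards [h2.coeFn_toLp] with x hx
        rw [hx]
    _ = ∫ x, φ x • 𝓕 f x := by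
        rw [SchwartzMap.fourier_coe]
        exact integral_fourier_smul_eq φ.integrable h1
    _ = _ := by simp [hφ]

/-- On `L¹ ∩ L²` the inverse Fourier transform of `L²` is given by the Fourier integral. -/
theorem fourierInv_toLp_ae_eq [CompleteSpace F] {f : E → F} (h1 : Integrable f) (h2 : MemLp f 2) :
    ((𝓕⁻ (h2.toLp f) : Lp F 2 (volume : Measure E)) : E → F) =ᵐ[volume] 𝓕⁻ f := by
  refine ae_eq_of_integral_contDiff_smul_eq
    ((Lp.memLp _).locallyIntegrable (by norm_num)) (continuous_fourierInv h1).locallyIntegrable ?_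
  intro g hg hgc
  have hg₁ : HasCompactSupport (Complex.ofRealCLM ∘ g) := hgc.comp_left rfl
  have hg₂ : ContDiff ℝ (⊤ : ℕ∞) (Complex.ofRealCLM ∘ g) := by fun_prop
  set φ := hg₁.toSchwartzMap hg₂
  have hφ : ∀ x, φ x = (g x : ℂ) := fun x => rfl
  have h := congrArg (fun T => T φ) (Lp.fourierInv_toTemperedDistribution_eq (h2.toLp f))
  simp only [TemperedDistribution.fourierInv_apply, Lp.toTemperedDistribution_apply] at h
  calc _ = ∫ x, φ x • (𝓕⁻ (h2.toLp f) : Lp F 2 (volume : Measure E)) x := by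
        simp [hφ]
    _ = ∫ x, (𝓕⁻ φ) x • f x := by
        rw [← h]
        refine integral_congr_ae ?_
        filter_upwards [h2.coeFn_toLp] with x hx
        rw [hx]
    _ = ∫ x, φ x • 𝓕⁻ f x := by
        rw [SchwartzMap.fourierInv_coe]
        exact integral_fourierInv_smul_eq φ.integrable h1
    _ = _ := by simp [hφ]

end FourierL1L2

/-! ### Bounded Fourier multipliers on L² -/

section Multiplier

variable {n : ℕ} {V : Type} [NormedAddCommGroup V] [InnerProductSpace ℂ V]

/-- `g ∈ L²` is the image of `w ∈ L²(ℝⁿ; V)` under the Fourier multiplier `ξ ↦ ⟪σ ξ, ·⟫`. -/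
def IsMultiplierImage [CompleteSpace V] (σ : RSpace n → V) (w : L2 n V) (g : L2 n ℂ) : Prop :=
  (fun ξ => (𝓕 g : L2 n ℂ) ξ) =ᵐ[volume] fun ξ => inner ℂ (σ ξ) ((𝓕 w : L2 n V) ξ)

variable {σ : RSpace n → V}

theorem memLp_inner_symbol (hσ : AEStronglyMeasurable σ) (hσ1 : ∀ ξ, ‖σ ξ‖ ≤ 1)
    {f : RSpace n → V} (hf : MemLp f 2) : MemLp (fun ξ => inner ℂ (σ ξ) (f ξ)) 2 :=
  hf.mono (hσ.inner hf.1) <| ae_of_all _ fun ξ => (norm_inner_le_norm _ _).trans <|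
    mul_le_of_le_one_left (norm_nonneg _) (hσ1 ξ)

variable [CompleteSpace V] {w w' : L2 n V} {g g' : L2 n ℂ}

theorem exists_isMultiplierImage (hσ : AEStronglyMeasurable σ) (hσ1 : ∀ ξ, ‖σ ξ‖ ≤ 1)
    (w : L2 n V) : ∃ g, IsMultiplierImage σ w g := by
  have hm := memLp_inner_symbol hσ hσ1 (Lp.memLp (𝓕 w : L2 n V))
  refine ⟨𝓕⁻ (hm.toLp _), ?_⟩
  have h1 : (𝓕 (𝓕⁻ (hm.toLp _) : L2 n ℂ) : L2 n ℂ) = hm.toLp _ := by simp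
  unfold IsMultiplierImage
  rw [h1]
  exact hm.coeFn_toLp

theorem IsMultiplierImage.sub (h : IsMultiplierImage σ w g) (h' : IsMultiplierImage σ w' g') :
    IsMultiplierImage σ (w - w') (g - g') := by
  unfold IsMultiplierImage at *
  have e1 : (𝓕 (g - g') : L2 n ℂ) = 𝓕 g - 𝓕 g' := (Lp.fourierTransformₗᵢ _ _).map_sub g g'
  have e2 : (𝓕 (w - w') : L2 n V) = 𝓕 w - 𝓕 w' := (Lp.fourierTransformₗᵢ _ _).map_sub w w'
  rw [e1, e2]
  filter_upwards [h, h', Lp.coeFn_sub (𝓕 g : L2 n ℂ) (𝓕 g'),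
    Lp.coeFn_sub (𝓕 w : L2 n V) (𝓕 w')] with ξ a b c d
  rw [c, d, Pi.sub_apply, Pi.sub_apply, a, b, inner_sub_right]

theorem IsMultiplierImage.norm_le (h : IsMultiplierImage σ w g) (hσ1 : ∀ ξ, ‖σ ξ‖ ≤ 1) :
    ‖g‖ ≤ ‖w‖ := by
  rw [← Lp.norm_fourier_eq g, ← Lp.norm_fourier_eq w]
  refine Lp.norm_le_norm_of_ae_le ?_
  filter_upwards [h] with ξ hξ
  rw [hξ]
  exact (norm_inner_le_norm _ _).trans (mul_le_of_le_one_left (norm_nonneg _) (hσ1 ξ))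

/-- Multipliers that converge boundedly and pointwise converge strongly. -/
theorem tendsto_of_isMultiplierImage {σs : ℕ → RSpace n → V} {ws : ℕ → L2 n V} {gs : ℕ → L2 n ℂ}
    (hσs : ∀ k, AEStronglyMeasurable (σs k)) (hσ : AEStronglyMeasurable σ)
    (hσs1 : ∀ k ξ, ‖σs k ξ‖ ≤ 1) (hσ1 : ∀ ξ, ‖σ ξ‖ ≤ 1)
    (hlim : ∀ ξ, Tendsto (fun k => σs k ξ) atTop (𝓝 (σ ξ))) (hw : Tendsto ws atTop (𝓝 w))
    (hgs : ∀ k, IsMultiplierImage (σs k) (ws k) (gs k)) (hg : IsMultiplierImage σ w g) :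
    Tendsto gs atTop (𝓝 g) := by
  -- `es k` applies the `k`-th multiplier to the limit `w`. This separates the two limits: `gs k -
  -- es k` is controlled by `‖ws k - w‖`, and `es k → g` is dominated convergence on the Fourier
  -- side.
  choose es hes using fun k => exists_isMultiplierImage (hσs k) (hσs1 k) w
  have h1 : Tendsto (fun k => gs k - es k) atTop (𝓝 0) := by
    refine squeeze_zero_norm (a := fun k => ‖ws k - w‖)
      (fun k => ((hgs k).sub (hes k)).norm_le (hσs1 k)) ?_
    simpa using (tendsto_iff_norm_sub_tendsto_zero.mp hw)
  have h2 : Tendsto (fun k => (𝓕 (es k) : L2 n ℂ)) atTop (𝓝 (𝓕 g)) := by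
    rw [Lp.tendsto_Lp_iff_tendsto_eLpNorm']
    have h3 : ∀ k, eLpNorm (⇑(𝓕 (es k) : L2 n ℂ) - ⇑(𝓕 g : L2 n ℂ)) 2 volume =
        eLpNorm (fun ξ => inner ℂ (σs k ξ - σ ξ) ((𝓕 w : L2 n V) ξ)) 2 volume := by
      intro k
      refine eLpNorm_congr_ae ?_
      filter_upwards [hes k, hg] with ξ a b
      simp only [Pi.sub_apply, a, b, inner_sub_left]
    simp only [h3]
    refine tendsto_eLpNorm_two_of_dominated
      (fun k => ((hσs k).sub hσ).inner (Lp.aestronglyMeasurable _))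
      ((Lp.memLp (𝓕 w : L2 n V)).norm.const_mul 2)
      (fun k => ae_of_all _ fun ξ => ?_) (ae_of_all _ fun ξ => ?_)
    · refine (norm_inner_le_norm _ _).trans ?_
      gcongr
      linarith [norm_sub_le (σs k ξ) (σ ξ), hσs1 k ξ, hσ1 ξ]
    · have := ((hlim ξ).sub_const (σ ξ)).inner (𝕜 := ℂ)
        (tendsto_const_nhds (x := (𝓕 w : L2 n V) ξ))
      simpa only [sub_self, inner_zero_left] using this
  have h4 : Tendsto es atTop (𝓝 g) := by
    have := (Lp.fourierTransformₗᵢ (RSpace n) ℂ).symm.continuous.continuousAt.tendsto.comp h2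
    convert this using 1
    · funext k
      exact ((Lp.fourierTransformₗᵢ (RSpace n) ℂ).symm_apply_apply (es k)).symm
    · congr 1
      exact ((Lp.fourierTransformₗᵢ (RSpace n) ℂ).symm_apply_apply g).symm
  simpa using h1.add h4

end Multiplier

/-! ### Real vectors inside ℂⁿ -/

section Complexify

variable {n : ℕ}

/-- The inclusion `ℝⁿ → ℂⁿ`. -/
def complexify (z : RSpace n) : CSpace n := WithLp.toLp 2 fun j => ((z j : ℝ) : ℂ)

@[simp] theorem complexify_apply (z : RSpace n) (j : Fin n) : complexify z j = (z j : ℂ) := rfl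

@[simp] theorem norm_complexify (z : RSpace n) : ‖complexify z‖ = ‖z‖ := by
  simp [complexify, EuclideanSpace.norm_eq]

theorem complexify_sub (z z' : RSpace n) : complexify (z - z') = complexify z - complexify z' := by
  ext j; simp

theorem complexify_smul (c : ℝ) (z : RSpace n) :
    complexify (c • z) = (c : ℂ) • complexify z := by
  ext j; simp

theorem continuous_complexify : Continuous (complexify : RSpace n → CSpace n) := by
  unfold complexify
  fun_prop

/-- The conjugation in the first slot is invisible on real vectors, so pairing with a real symbol is
the plain dot product. -/
theorem inner_complexify (z : RSpace n) (v : CSpace n) :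
    inner ℂ (complexify z) v = ∑ j, (z j : ℂ) * v j := by
  simp [PiLp.inner_apply, mul_comm]

end Complexify

/-! ### Modulated Gaussians and their Fourier transforms -/

section Gaussian

variable {E : Type*} [NormedAddCommGroup E] [InnerProductSpace ℝ E]

/-- A modulated Gaussian. -/
def modGauss (t : ℝ) (x ξ : E) : ℂ :=
  Complex.exp (-(Real.pi * t : ℝ) * ‖ξ‖ ^ 2 + 2 * Real.pi * Complex.I * (inner ℝ x ξ : ℝ))

theorem norm_modGauss (t : ℝ) (x ξ : E) :
    ‖modGauss t x ξ‖ = Real.exp (-(Real.pi * t) * ‖ξ‖ ^ 2) := by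
  rw [modGauss, Complex.norm_exp]
  congr 1
  simp [← Complex.ofReal_pow, ← Complex.ofReal_mul, ← Complex.ofReal_neg]

theorem continuous_modGauss (t : ℝ) (x : E) : Continuous (modGauss t x) := by
  unfold modGauss
  fun_prop

variable [FiniteDimensional ℝ E] [MeasurableSpace E] [BorelSpace E]

theorem integrable_exp_neg_mul_sq_norm {b : ℝ} (hb : 0 < b) :
    Integrable fun ξ : E => Real.exp (-b * ‖ξ‖ ^ 2) := by
  have h := (GaussianFourier.integrable_cexp_neg_mul_sq_norm_add (b := (b : ℂ)) (V := E)
    (by simpa using hb) 0 0).norm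
  refine h.congr (ae_of_all _ fun ξ => ?_)
  simp only [Complex.norm_exp]
  congr 1
  simp [← Complex.ofReal_pow, ← Complex.ofReal_mul, ← Complex.ofReal_neg]

/-- Half of the Gaussian decay absorbs the factor `‖ξ‖`. -/
theorem integrable_norm_mul_exp_neg_mul_sq_norm {b : ℝ} (hb : 0 < b) :
    Integrable fun ξ : E => ‖ξ‖ * Real.exp (-b * ‖ξ‖ ^ 2) := by
  refine ((integrable_exp_neg_mul_sq_norm (E := E) (half_pos hb)).const_mul (1 + 2 / b)).mono'
    (by fun_prop) (ae_of_all _ fun ξ => ?_)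
  rw [Real.norm_of_nonneg (by positivity)]
  have e : Real.exp (-(b / 2) * ‖ξ‖ ^ 2) =
      Real.exp (b / 2 * ‖ξ‖ ^ 2) * Real.exp (-b * ‖ξ‖ ^ 2) := by
    rw [← Real.exp_add]; congr 1; ring
  rw [e, ← mul_assoc]
  gcongr
  calc ‖ξ‖ ≤ 1 + ‖ξ‖ ^ 2 := by nlinarith [sq_nonneg (‖ξ‖ - 1)]
    _ ≤ (1 + 2 / b) * (1 + b / 2 * ‖ξ‖ ^ 2) := by
        have : (1 + 2 / b) * (1 + b / 2 * ‖ξ‖ ^ 2) =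
          1 + ‖ξ‖ ^ 2 + (2 / b + b / 2 * ‖ξ‖ ^ 2) := by field_simp; ring
        rw [this]
        have : 0 ≤ 2 / b + b / 2 * ‖ξ‖ ^ 2 := by positivity
        linarith
    _ ≤ _ := by
        gcongr
        linarith [Real.add_one_le_exp (b / 2 * ‖ξ‖ ^ 2)]

theorem integrable_modGauss {t : ℝ} (ht : 0 < t) (x : E) : Integrable (modGauss t x) := by
  refine (integrable_exp_neg_mul_sq_norm (E := E) (mul_pos Real.pi_pos ht)).mono'
    (continuous_modGauss t x).aestronglyMeasurable (ae_of_all _ fun ξ => ?_)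
  rw [norm_modGauss]

/-- Modulation by `x` becomes translation by `x`, so the result depends only on `x - y` and can
serve as a convolution kernel. -/
theorem fourier_modGauss {t : ℝ} (ht : 0 < t) (x y : E) :
    𝓕 (modGauss t x) y = ((t⁻¹ ^ ((Module.finrank ℝ E : ℝ) / 2) *
      Real.exp (-Real.pi * ‖x - y‖ ^ 2 / t) : ℝ) : ℂ) := by
  have h := fourier_gaussian_innerProductSpace' (b := ((Real.pi * t : ℝ) : ℂ)) (V := E)
    (by simpa using mul_pos Real.pi_pos ht) x y
  unfold modGauss
  rw [h, Complex.ofReal_mul (_ ^ _), Complex.ofReal_cpow (by positivity), Complex.ofReal_exp]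
  have hpi : (Real.pi : ℂ) ≠ 0 := by exact_mod_cast Real.pi_ne_zero
  have ht' : (t : ℂ) ≠ 0 := by exact_mod_cast ht.ne'
  congr 2
  · push_cast; field_simp
  · push_cast; rfl
  · push_cast; field_simp

/-- A factor `⟪ξ, e⟫` corresponds to differentiation in the direction `e`. The derivative of the
transform along `y + s • e` at `s = 0` is computed under the integral (`d1`) and from the closed
form (`d2`). -/
theorem fourier_inner_mul_modGauss {t : ℝ} (ht : 0 < t) (x y e : E) :
    𝓕 (fun ξ => ((inner ℝ ξ e : ℝ) : ℂ) * modGauss t x ξ) y =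
      Complex.I * ((t⁻¹ ^ ((Module.finrank ℝ E : ℝ) / 2) * t⁻¹ *
        Real.exp (-Real.pi * ‖x - y‖ ^ 2 / t) * inner ℝ (x - y) e : ℝ) : ℂ) := by
  have hi : Integrable fun ξ => ‖ξ‖ * ‖modGauss t x ξ‖ := by
    simp only [norm_modGauss]
    exact integrable_norm_mul_exp_neg_mul_sq_norm (mul_pos Real.pi_pos ht)
  have h1 := Real.hasFDerivAt_fourier (integrable_modGauss ht x) hi y
  set A := t⁻¹ ^ ((Module.finrank ℝ E : ℝ) / 2)
  have d1 : HasDerivAt (fun s : ℝ => 𝓕 (modGauss t x) (y + s • e))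
      (𝓕 (VectorFourier.fourierSMulRight (innerSL ℝ) (modGauss t x)) y e) 0 := by
    have l : HasDerivAt (fun s : ℝ => y + s • e) e 0 := by
      simpa using ((hasDerivAt_id (0 : ℝ)).smul_const e).const_add y
    have h1' : HasFDerivAt (𝓕 (modGauss t x))
        (𝓕 (VectorFourier.fourierSMulRight (innerSL ℝ) (modGauss t x)) y) (y + (0 : ℝ) • e) := by
      simpa using h1
    exact h1'.comp_hasDerivAt 0 l
  have d2 : HasDerivAt (fun s : ℝ => 𝓕 (modGauss t x) (y + s • e))
      ((A * (Real.exp (-Real.pi * ‖x - y‖ ^ 2 / t) * (2 * Real.pi / t * inner ℝ (x - y) e)) : ℝ) : ℂ)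
      0 := by
    have e0 : (fun s : ℝ => 𝓕 (modGauss t x) (y + s • e)) = fun s : ℝ => ((A *
        Real.exp (-Real.pi / t * (‖x - y‖ ^ 2 - s * (2 * inner ℝ (x - y) e) + s ^ 2 * ‖e‖ ^ 2)) :
          ℝ) : ℂ) := by
      funext s
      rw [fourier_modGauss ht]
      congr 3
      have : ‖x - (y + s • e)‖ ^ 2 =
          ‖x - y‖ ^ 2 - s * (2 * inner ℝ (x - y) e) + s ^ 2 * ‖e‖ ^ 2 := by
        rw [← sub_sub, norm_sub_sq_real, inner_smul_right, norm_smul, mul_pow]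
        simp
        ring
      rw [this]
      ring
    rw [e0]
    refine HasDerivAt.ofReal_comp ?_
    have p : HasDerivAt (fun s : ℝ => ‖x - y‖ ^ 2 - s * (2 * inner ℝ (x - y) e) + s ^ 2 * ‖e‖ ^ 2)
        (-(2 * inner ℝ (x - y) e)) 0 := by
      have := (((hasDerivAt_id (0 : ℝ)).mul_const (2 * inner ℝ (x - y) e)).const_sub
        (‖x - y‖ ^ 2)).add (((hasDerivAt_id (0 : ℝ)).pow 2).mul_const (‖e‖ ^ 2))
      exact HasDerivAt.congr_deriv this (by simp)
    have q := ((p.const_mul (-Real.pi / t)).exp.const_mul A)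
    refine q.congr_deriv ?_
    have : -Real.pi / t * (‖x - y‖ ^ 2 - 0 * (2 * inner ℝ (x - y) e) + 0 ^ 2 * ‖e‖ ^ 2) =
      -Real.pi * ‖x - y‖ ^ 2 / t := by ring
    rw [this]
    ring
  have h3 := d1.unique d2
  have h4 : 𝓕 (VectorFourier.fourierSMulRight (innerSL ℝ) (modGauss t x)) y e =
      -(2 * Real.pi * Complex.I) * 𝓕 (fun ξ => ((inner ℝ ξ e : ℝ) : ℂ) * modGauss t x ξ) y := by
    rw [Real.fourier_continuousLinearMap_apply]
    · have : (fun ξ => VectorFourier.fourierSMulRight (innerSL ℝ) (modGauss t x) ξ e) =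
          fun ξ => (-(2 * Real.pi * Complex.I)) •
            (((inner ℝ ξ e : ℝ) : ℂ) * modGauss t x ξ) := by
        funext ξ
        rw [VectorFourier.fourierSMulRight_apply, innerSL_apply_apply]
        simp
      rw [this]
      exact congrFun (VectorFourier.fourierIntegral_const_smul _ _ _ _ _) y
    · refine (hi.const_mul (2 * Real.pi * ‖innerSL ℝ (E := E)‖)).mono' ?_ (ae_of_all _ fun ξ => ?_)
      · exact (integrable_modGauss ht x).1.fourierSMulRight
      · refine (VectorFourier.norm_fourierSMulRight_le _ _ _).trans (le_of_eq ?_)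
        ring
  rw [h4] at h3
  have hpi : (2 * Real.pi * Complex.I : ℂ) ≠ 0 := by
    simp [Real.pi_ne_zero]
  have ht' : (t : ℂ) ≠ 0 := by exact_mod_cast ht.ne'
  refine mul_left_cancel₀ (neg_ne_zero.mpr hpi) (h3.trans ?_)
  push_cast
  have := Complex.I_mul_I
  linear_combination (2 * Real.pi * (A : ℂ) * (t : ℂ)⁻¹ *
    Complex.exp (-Real.pi * ‖x - y‖ ^ 2 / t) * (inner ℝ (x - y) e : ℝ)) * this

end Gaussian

/-! ### Gaussian regularisation of the Riesz transforms -/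

variable {n : ℕ}

/-- The scalar factor of the kernel of `ξ e^{-πt|ξ|²}`. -/
def gaussFactor (n : ℕ) (t : ℝ) (z : RSpace n) : ℝ :=
  t⁻¹ ^ ((n : ℝ) / 2) * t⁻¹ * Real.exp (-Real.pi * ‖z‖ ^ 2 / t)

/-- The Fourier multiplier `ξ e^{-πt|ξ|²}` applied to `f`. -/
def gaussMultiplier (t : ℝ) (f : RSpace n → CSpace n) (x : RSpace n) : ℂ :=
  ∫ ξ, modGauss t x ξ * inner ℂ (complexify ξ) (𝓕 f ξ)

theorem fourier_apply_coord {f : RSpace n → CSpace n} (hf : Integrable f) (ξ : RSpace n)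
    (j : Fin n) : 𝓕 f ξ j = 𝓕 (fun y => f y j) ξ := by
  rw [Real.fourier_eq, Real.fourier_eq]
  have := (EuclideanSpace.proj j : CSpace n →L[ℂ] ℂ).integral_comp_comm
    ((Real.fourierIntegral_convergent_iff ξ).mpr hf)
  simpa using this.symm

theorem integrable_coord {f : RSpace n → CSpace n} (hf : Integrable f) (j : Fin n) :
    Integrable fun y => f y j :=
  (EuclideanSpace.proj j : CSpace n →L[ℂ] ℂ).integrable_comp hf

theorem integrable_coord_mul_modGauss {t : ℝ} (ht : 0 < t) (x : RSpace n) (j : Fin n) :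
    Integrable fun ξ : RSpace n => (ξ j : ℂ) * modGauss t x ξ := by
  refine (integrable_norm_mul_exp_neg_mul_sq_norm (E := RSpace n)
    (mul_pos Real.pi_pos ht)).mono' ?_ (ae_of_all _ fun ξ => ?_)
  · have := continuous_modGauss t x
    fun_prop
  · rw [norm_mul, norm_modGauss, Complex.norm_real]
    gcongr
    exact PiLp.norm_apply_le ξ j

/-- Coordinate by coordinate, the multiplication formula moves the transform from `f` to the
weighted Gaussian, which exhibits the multiplier as convolution with an explicit smooth kernel. -/
theorem gaussMultiplier_eq {t : ℝ} (ht : 0 < t) {f : RSpace n → CSpace n} (hf : Integrable f)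
    (x : RSpace n) : gaussMultiplier t f x =
      ∫ y, Complex.I * inner ℂ (complexify (gaussFactor n t (x - y) • (x - y))) (f y) := by
  have e : ∀ (y : RSpace n) (j : Fin n), 𝓕 (fun ξ : RSpace n => (ξ j : ℂ) * modGauss t x ξ) y =
      Complex.I * ((gaussFactor n t (x - y) * (x - y) j : ℝ) : ℂ) := fun y j => by
    have := fourier_inner_mul_modGauss ht x y (EuclideanSpace.single j (1 : ℝ))
    simpa [gaussFactor, EuclideanSpace.inner_single_right] using this
  have hbd : ∀ j, Integrable fun ξ : RSpace n =>
      ((ξ j : ℂ) * modGauss t x ξ) * 𝓕 (fun y => f y j) ξ := fun j =>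
    (integrable_coord_mul_modGauss ht x j).mul_bdd (c := ∫ y, ‖f y j‖)
      (continuous_fourier (integrable_coord hf j)).aestronglyMeasurable
      (ae_of_all _ fun ξ => norm_fourier_le ξ)
  have hbd' : ∀ j, Integrable fun y : RSpace n =>
      𝓕 (fun ξ : RSpace n => (ξ j : ℂ) * modGauss t x ξ) y * f y j := fun j =>
    (integrable_coord hf j).bdd_mul (c := ∫ ξ : RSpace n, ‖(ξ j : ℂ) * modGauss t x ξ‖)
      (continuous_fourier (integrable_coord_mul_modGauss ht x j)).aestronglyMeasurable
      (ae_of_all _ fun ξ => norm_fourier_le ξ)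
  calc gaussMultiplier t f x
      = ∫ ξ : RSpace n, ∑ j, ((ξ j : ℂ) * modGauss t x ξ) * 𝓕 (fun y => f y j) ξ := by
        refine integral_congr_ae (ae_of_all _ fun ξ => ?_)
        simp only [inner_complexify, Finset.mul_sum]
        refine Finset.sum_congr rfl fun j _ => ?_
        rw [fourier_apply_coord hf]
        ring
    _ = ∑ j, ∫ ξ : RSpace n, ((ξ j : ℂ) * modGauss t x ξ) * 𝓕 (fun y => f y j) ξ :=
        integral_finsetSum _ fun j _ => hbd j
    _ = ∑ j, ∫ y : RSpace n, 𝓕 (fun ξ : RSpace n => (ξ j : ℂ) * modGauss t x ξ) y * f y j := by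
        refine Finset.sum_congr rfl fun j _ => ?_
        exact (integral_fourier_smul_eq (integrable_coord_mul_modGauss ht x j)
          (integrable_coord hf j)).symm
    _ = ∫ y : RSpace n, ∑ j, 𝓕 (fun ξ : RSpace n => (ξ j : ℂ) * modGauss t x ξ) y * f y j :=
        (integral_finsetSum _ fun j _ => hbd' j).symm
    _ = _ := by
        refine integral_congr_ae (ae_of_all _ fun y => ?_)
        simp only [inner_complexify, Finset.mul_sum, e]
        refine Finset.sum_congr rfl fun j _ => ?_
        simp
        ring

/-- The regularisation of the symbol `ξ / |ξ|` by Gaussians. -/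
def truncSymbol (a b : ℝ) (ξ : RSpace n) : CSpace n :=
  complexify ((∫ t in Set.Ioc a b, t ^ (-(1 / 2) : ℝ) * Real.exp (-(Real.pi * t) * ‖ξ‖ ^ 2)) • ξ)

/-- For `t > a` the Gaussian is dominated by the one at time `a`, and `𝓕 f` is bounded; the majorant
is a product. This justifies Fubini in `t` and `ξ`. -/
theorem integrable_prod_gaussMultiplier {a b : ℝ} (ha : 0 < a) {f : RSpace n → CSpace n}
    (hf : Integrable f) (x : RSpace n) :
    Integrable (fun p : ℝ × RSpace n => ((p.1 ^ (-(1 / 2) : ℝ) : ℝ) : ℂ) *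
      (modGauss p.1 x p.2 * inner ℂ (complexify p.2) (𝓕 f p.2)))
      ((volume.restrict (Set.Ioc a b)).prod volume) := by
  have hi1 : Integrable (fun t : ℝ => t ^ (-(1 / 2) : ℝ)) (volume.restrict (Set.Ioc a b)) := by
    rcases le_total a b with hab | hab
    · refine ((ContinuousOn.integrableOn_Icc fun t ht => ?_).mono_set Set.Ioc_subset_Icc_self)
      exact (Real.continuousAt_rpow_const _ _ (Or.inl (ha.trans_le ht.1).ne')).continuousWithinAt
    · simp [Set.Ioc_eq_empty_of_le hab]
  have hi2 := (integrable_norm_mul_exp_neg_mul_sq_norm (E := RSpace n)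
    (mul_pos Real.pi_pos ha)).mul_const (∫ y, ‖f y‖)
  have hae : ∀ᵐ p : ℝ × RSpace n ∂((volume.restrict (Set.Ioc a b)).prod volume),
      p.1 ∈ Set.Ioc a b :=
    Measure.quasiMeasurePreserving_fst.ae (ae_restrict_mem measurableSet_Ioc)
  refine (hi1.mul_prod hi2).mono' ?_ ?_
  · refine AEStronglyMeasurable.mul ?_ (AEStronglyMeasurable.mul ?_ ?_)
    · exact (Complex.measurable_ofReal.comp (measurable_fst.pow_const _)).aestronglyMeasurable
    · refine Continuous.aestronglyMeasurable ?_
      unfold modGauss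
      fun_prop
    · refine Continuous.aestronglyMeasurable ?_
      exact (continuous_complexify.comp continuous_snd).inner
        ((continuous_fourier hf).comp continuous_snd)
  · filter_upwards [hae] with p hp
    have hp0 : 0 < p.1 := ha.trans hp.1
    rw [norm_mul, norm_mul, norm_modGauss, Complex.norm_real,
      Real.norm_of_nonneg (by positivity)]
    have h1 : ‖inner ℂ (complexify p.2) (𝓕 f p.2)‖ ≤ ‖p.2‖ * ∫ y, ‖f y‖ := by
      refine (norm_inner_le_norm _ _).trans ?_
      rw [norm_complexify]
      gcongr
      exact norm_fourier_le _
    have h2 : Real.exp (-(Real.pi * p.1) * ‖p.2‖ ^ 2) ≤ Real.exp (-(Real.pi * a) * ‖p.2‖ ^ 2) := by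
      rw [Real.exp_le_exp]
      have := hp.1.le
      rw [neg_mul, neg_mul]
      gcongr
    calc _ ≤ p.1 ^ (-(1 / 2) : ℝ) * (Real.exp (-(Real.pi * a) * ‖p.2‖ ^ 2) *
          (‖p.2‖ * ∫ y, ‖f y‖)) := by gcongr
      _ = _ := by ring

theorem integrableOn_gaussMultiplier {a b : ℝ} (ha : 0 < a) {f : RSpace n → CSpace n}
    (hf : Integrable f) (x : RSpace n) :
    IntegrableOn (fun t : ℝ => ((t ^ (-(1 / 2) : ℝ) : ℝ) : ℂ) * gaussMultiplier t f x)
      (Set.Ioc a b) := by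
  have := (integrable_prod_gaussMultiplier (b := b) ha hf x).integral_prod_left
  unfold IntegrableOn
  simpa only [gaussMultiplier, integral_const_mul] using this

theorem inner_truncSymbol (a b : ℝ) (ξ : RSpace n) (v : CSpace n) :
    inner ℂ (truncSymbol a b ξ) v = ((∫ t in Set.Ioc a b,
      t ^ (-(1 / 2) : ℝ) * Real.exp (-(Real.pi * t) * ‖ξ‖ ^ 2) : ℝ) : ℂ) *
        inner ℂ (complexify ξ) v := by
  rw [truncSymbol, complexify_smul, inner_smul_left, Complex.conj_ofReal]

theorem fourierInv_inner_truncSymbol {a b : ℝ} (ha : 0 < a) {f : RSpace n → CSpace n}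
    (hf : Integrable f) (x : RSpace n) :
    𝓕⁻ (fun ξ => inner ℂ (truncSymbol a b ξ) (𝓕 f ξ)) x =
      ∫ t in Set.Ioc a b, ((t ^ (-(1 / 2) : ℝ) : ℝ) : ℂ) * gaussMultiplier t f x := by
  simp only [gaussMultiplier, ← integral_const_mul]
  rw [integral_integral_swap (integrable_prod_gaussMultiplier ha hf x), Real.fourierInv_eq']
  refine integral_congr_ae (ae_of_all _ fun ξ => ?_)
  simp only [inner_truncSymbol, smul_eq_mul]
  rw [← integral_complex_ofReal, ← mul_assoc, mul_comm (Complex.exp _), mul_assoc,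
    ← integral_mul_const]
  refine integral_congr_ae (ae_of_all _ fun t => ?_)
  simp only [modGauss]
  rw [Complex.exp_add, real_inner_comm ξ x]
  push_cast
  have : Complex.exp (2 * Real.pi * (inner ℝ ξ x : ℝ) * Complex.I) =
    Complex.exp (2 * Real.pi * Complex.I * (inner ℝ ξ x : ℝ)) := by congr 1; ring
  rw [this]
  ring

/-! ### Properties of the regularised symbol -/

/-- This is Γ(1/2) = √π; the weight `t^(-1/2)` and the factor π make the constant exactly 1. -/
theorem integral_Ioi_gauss {s : ℝ} (hs : 0 < s) :
    ∫ t in Set.Ioi (0 : ℝ), t ^ (-(1 / 2) : ℝ) * Real.exp (-(Real.pi * t) * s ^ 2) = s⁻¹ := by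
  have h := Real.integral_rpow_mul_exp_neg_mul_Ioi (a := 1 / 2) (r := Real.pi * s ^ 2)
    (by norm_num) (by positivity)
  have : ∀ t : ℝ, t ^ (-(1 / 2) : ℝ) * Real.exp (-(Real.pi * t) * s ^ 2) =
      t ^ ((1 / 2 : ℝ) - 1) * Real.exp (-(Real.pi * s ^ 2 * t)) := fun t => by
    congr 2 <;> ring
  simp only [this]
  rw [h, Real.Gamma_one_half_eq, ← Real.sqrt_eq_rpow, ← Real.sqrt_mul (by positivity)]
  have : 1 / (Real.pi * s ^ 2) * Real.pi = (s⁻¹) ^ 2 := by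
    field_simp
  rw [this, Real.sqrt_sq (by positivity)]

theorem integrableOn_Ioi_gauss {s : ℝ} (hs : 0 < s) :
    IntegrableOn (fun t : ℝ => t ^ (-(1 / 2) : ℝ) * Real.exp (-(Real.pi * t) * s ^ 2))
      (Set.Ioi 0) := by
  -- A non-integrable function has integral 0 by convention, whereas the value found is `s⁻¹ ≠ 0`.
  by_contra h
  have := integral_undef h
  rw [integral_Ioi_gauss hs] at this
  exact hs.ne' (inv_eq_zero.mp this)

/-- The integrand is positive, so truncation only decreases the full integral `‖ξ‖⁻¹`. -/
theorem norm_truncSymbol_le {a b : ℝ} (ha : 0 < a) (ξ : RSpace n) : ‖truncSymbol a b ξ‖ ≤ 1 := by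
  rw [truncSymbol, norm_complexify, norm_smul]
  rcases eq_or_ne ξ 0 with rfl | hξ
  · simp
  have hs := norm_pos_iff.mpr hξ
  have h0 : ∀ t ∈ Set.Ioi (0 : ℝ),
      0 ≤ t ^ (-(1 / 2) : ℝ) * Real.exp (-(Real.pi * t) * ‖ξ‖ ^ 2) := fun t ht => by
    have : 0 < t := ht
    positivity
  have hsub : Set.Ioc a b ⊆ Set.Ioi 0 := fun t ht => ha.trans ht.1
  rw [Real.norm_of_nonneg (setIntegral_nonneg measurableSet_Ioc fun t ht => h0 t (hsub ht))]
  calc _ ≤ ‖ξ‖⁻¹ * ‖ξ‖ := by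
        gcongr
        rw [← integral_Ioi_gauss hs]
        exact setIntegral_mono_set (integrableOn_Ioi_gauss hs)
          ((ae_restrict_mem measurableSet_Ioi).mono h0) hsub.eventuallyLE
    _ = 1 := inv_mul_cancel₀ hs.ne'

theorem measurable_truncSymbol (a b : ℝ) : Measurable (truncSymbol (n := n) a b) := by
  unfold truncSymbol
  refine continuous_complexify.measurable.comp (Measurable.fun_smul ?_ measurable_id)
  refine StronglyMeasurable.measurable ?_
  refine StronglyMeasurable.integral_prod_right
    (f := fun (ξ : RSpace n) (t : ℝ) =>
      t ^ (-(1 / 2) : ℝ) * Real.exp (-(Real.pi * t) * ‖ξ‖ ^ 2)) ?_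
  refine Measurable.stronglyMeasurable ?_
  simp only [Function.uncurry_def]
  fun_prop

/-- The symbol `ξ / |ξ|` of the vector of Riesz transforms. -/
def rieszSymbol (ξ : RSpace n) : CSpace n := complexify (‖ξ‖⁻¹ • ξ)

theorem norm_rieszSymbol_le (ξ : RSpace n) : ‖rieszSymbol ξ‖ ≤ 1 := by
  rw [rieszSymbol, norm_complexify, norm_smul, norm_inv, norm_norm]
  exact inv_mul_le_one

theorem measurable_rieszSymbol : Measurable (rieszSymbol (n := n)) :=
  continuous_complexify.measurable.comp (measurable_norm.inv.smul measurable_id)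

theorem tendsto_truncSymbol (ξ : RSpace n) :
    Tendsto (fun k : ℕ => truncSymbol ((k + 1 : ℝ)⁻¹) (k + 1) ξ) atTop (𝓝 (rieszSymbol ξ)) := by
  rcases eq_or_ne ξ 0 with rfl | hξ
  · simp [truncSymbol, rieszSymbol]
  have hs := norm_pos_iff.mpr hξ
  refine (continuous_complexify.tendsto _).comp (Tendsto.smul_const ?_ ξ)
  rw [← integral_Ioi_gauss hs]
  have hcov : AECover (volume.restrict (Set.Ioi (0 : ℝ))) atTop
      fun k : ℕ => Set.Ioc ((k + 1 : ℝ)⁻¹) (k + 1) := by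
    refine (aecover_Ioi_of_Ioi ?_).inter (aecover_Iic ?_)
    · simpa [one_div] using tendsto_one_div_add_atTop_nhds_zero_nat (𝕜 := ℝ)
    · exact tendsto_atTop_add_const_right _ _ tendsto_natCast_atTop_atTop
  have := hcov.integral_tendsto_of_countably_generated (integrableOn_Ioi_gauss hs)
  refine this.congr fun k => ?_
  rw [Measure.restrict_restrict measurableSet_Ioc]
  congr 2
  refine Set.inter_eq_left.mpr fun t ht => ?_
  exact lt_trans (by positivity) ht.1

/-! ### Kernel estimates away from the diagonal -/

theorem continuous_gaussFactor (t : ℝ) : Continuous (gaussFactor n t) := by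
  unfold gaussFactor
  fun_prop

/-- A crude bound for fixed `t`, whose only role is to make the kernel integrable against `f`. -/
theorem norm_gaussFactor_smul_le {t : ℝ} (ht : 0 < t) (z : RSpace n) :
    ‖gaussFactor n t z • z‖ ≤ t⁻¹ ^ ((n : ℝ) / 2) * t⁻¹ * (1 + t / Real.pi) := by
  rw [norm_smul, gaussFactor, Real.norm_of_nonneg (by positivity), mul_assoc (_ * _)]
  gcongr
  set u := Real.pi * ‖z‖ ^ 2 / t with hu
  have e : -Real.pi * ‖z‖ ^ 2 / t = -u := by rw [hu]; ring
  rw [e]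
  have h1 : ‖z‖ ≤ 1 + t / Real.pi * u := by
    have : t / Real.pi * u = ‖z‖ ^ 2 := by
      rw [hu]; field_simp
    rw [this]
    nlinarith [sq_nonneg (‖z‖ - 1)]
  have hu0 : 0 ≤ u := by positivity
  have h2 : Real.exp (-u) ≤ 1 := Real.exp_le_one_iff.mpr (by linarith)
  have h3 : u * Real.exp (-u) ≤ 1 := by
    rw [Real.exp_neg, ← div_eq_mul_inv, div_le_one (Real.exp_pos _)]
    linarith [Real.add_one_le_exp u]
  have h4 : 0 ≤ t / Real.pi := by positivity
  calc Real.exp (-u) * ‖z‖ ≤ Real.exp (-u) * (1 + t / Real.pi * u) := by gcongr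
    _ = Real.exp (-u) + t / Real.pi * (u * Real.exp (-u)) := by ring
    _ ≤ 1 + t / Real.pi * 1 := by gcongr
    _ = _ := by ring

/-- Lipschitz bound for the kernel of `ξ e^{-πt|ξ|²}` along a segment that stays away from `0`. -/
theorem norm_gaussFactor_smul_sub_le {t d : ℝ} (ht : 0 < t) (hd : 0 ≤ d) {z z' : RSpace n}
    (h : ∀ s ∈ Set.Icc (0 : ℝ) 1, d / 2 ≤ ‖z' + s • (z - z')‖) :
    ‖gaussFactor n t z • z - gaussFactor n t z' • z'‖ ≤
      t⁻¹ ^ ((n : ℝ) / 2) * t⁻¹ * (4 * Real.exp (-(Real.pi / 8) * d ^ 2 / t) * ‖z - z'‖) := by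
  set v := z - z' with hv
  set A := t⁻¹ ^ ((n : ℝ) / 2) * t⁻¹ with hA
  have hA0 : 0 ≤ A := by positivity
  let ζ : ℝ → RSpace n := fun s => z' + s • v
  have hζ : ∀ s, HasDerivAt ζ v s := fun s => by
    exact (((hasDerivAt_id s).smul_const v).const_add z').congr_deriv (by simp)
  let φ : ℝ → RSpace n := fun s => gaussFactor n t (ζ s) • ζ s
  let φ' : ℝ → RSpace n := fun s => gaussFactor n t (ζ s) • v +
    (gaussFactor n t (ζ s) * (-Real.pi / t * (2 * inner ℝ (ζ s) v))) • ζ s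
  have hφ : ∀ s, HasDerivAt φ (φ' s) s := fun s => by
    have h1 : HasDerivAt (fun s => gaussFactor n t (ζ s))
        (gaussFactor n t (ζ s) * (-Real.pi / t * (2 * inner ℝ (ζ s) v))) s := by
      have := (((hζ s).norm_sq.const_mul (-Real.pi / t)).exp.const_mul A)
      have e : ∀ w : RSpace n, gaussFactor n t w = A * Real.exp (-Real.pi / t * ‖w‖ ^ 2) :=
        fun w => by
          rw [gaussFactor, ← hA]; congr 2; ring
      simp only [e]
      refine this.congr_deriv ?_
      ring
    exact h1.smul (hζ s)
  have hbound : ∀ s ∈ Set.Icc (0 : ℝ) 1, ‖φ' s‖ ≤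
      A * (4 * Real.exp (-(Real.pi / 8) * d ^ 2 / t) * ‖v‖) := fun s hs => by
    set p := Real.pi * ‖ζ s‖ ^ 2 / t with hp
    have hp0 : 0 ≤ p := by positivity
    have hg : gaussFactor n t (ζ s) = A * Real.exp (-p) := by
      rw [gaussFactor, ← hA]; congr 2; rw [hp]; ring
    have hg0 : 0 ≤ gaussFactor n t (ζ s) := by rw [hg]; positivity
    have h1 : ‖φ' s‖ ≤ A * Real.exp (-p) * ((1 + 2 * p) * ‖v‖) := by
      calc ‖φ' s‖ ≤ ‖gaussFactor n t (ζ s) • v‖ +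
            ‖(gaussFactor n t (ζ s) * (-Real.pi / t * (2 * inner ℝ (ζ s) v))) • ζ s‖ :=
            norm_add_le _ _
        _ = gaussFactor n t (ζ s) * (‖v‖ + Real.pi / t * 2 * |inner ℝ (ζ s) v| * ‖ζ s‖) := by
            rw [norm_smul, norm_smul, norm_mul, norm_mul, norm_mul, norm_div, norm_neg,
              Real.norm_of_nonneg hg0, Real.norm_of_nonneg Real.pi_pos.le,
              Real.norm_of_nonneg ht.le, Real.norm_eq_abs (inner ℝ _ _)]
            simp
            ring
        _ ≤ gaussFactor n t (ζ s) * (‖v‖ + Real.pi / t * 2 * (‖ζ s‖ * ‖v‖) * ‖ζ s‖) := by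
            gcongr
            exact abs_real_inner_le_norm _ _
        _ = _ := by rw [hg, hp]; ring
    -- Half of the exponent absorbs the polynomial, as `1 + 2p ≤ 4 (1 + p/2)` and `1 + p/2 ≤
    -- e^(p/2)`. The other half, with `‖ζ s‖ ≥ d/2`, leaves the rate π/8.
    have h2 : Real.exp (-p) * (1 + 2 * p) ≤ 4 * Real.exp (-(p / 2)) := by
      have e : Real.exp (-p) = Real.exp (-(p / 2)) * Real.exp (-(p / 2)) := by
        rw [← Real.exp_add]; congr 1; ring
      have e2 : Real.exp (-(p / 2)) * (1 + p / 2) ≤ 1 := by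
        rw [Real.exp_neg, inv_mul_le_one₀ (Real.exp_pos _)]
        linarith [Real.add_one_le_exp (p / 2)]
      calc _ ≤ Real.exp (-p) * (4 * (1 + p / 2)) := by gcongr; linarith
        _ = 4 * Real.exp (-(p / 2)) * (Real.exp (-(p / 2)) * (1 + p / 2)) := by rw [e]; ring
        _ ≤ _ := mul_le_of_le_one_right (by positivity) e2
    have h3 : Real.exp (-(p / 2)) ≤ Real.exp (-(Real.pi / 8) * d ^ 2 / t) := by
      rw [Real.exp_le_exp, hp]
      have : (d / 2) ^ 2 ≤ ‖ζ s‖ ^ 2 := by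
        have := h s hs
        gcongr
      have h4 : -(Real.pi / 8) * d ^ 2 / t = -(Real.pi * (d / 2) ^ 2 / t / 2) := by ring
      rw [h4]
      gcongr
    calc _ ≤ A * Real.exp (-p) * ((1 + 2 * p) * ‖v‖) := h1
      _ = A * ((Real.exp (-p) * (1 + 2 * p)) * ‖v‖) := by ring
      _ ≤ A * ((4 * Real.exp (-(p / 2))) * ‖v‖) := by gcongr
      _ ≤ _ := by gcongr
  have hmvt := (convex_Icc (0 : ℝ) 1).norm_image_sub_le_of_norm_hasDerivWithin_le
    (fun s _ => (hφ s).hasDerivWithinAt) hbound (Set.left_mem_Icc.mpr zero_le_one)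
    (Set.right_mem_Icc.mpr zero_le_one)
  have e1 : φ 1 = gaussFactor n t z • z := by
    have : z' + (1 : ℝ) • v = z := by rw [one_smul, hv]; abel
    simp only [φ, ζ, this]
  have e0 : φ 0 = gaussFactor n t z' • z' := by simp [φ, ζ]
  rw [e1, e0] at hmvt
  simpa using hmvt

/-- Raise `v ≤ e^v` at `v = c s / p` to the power `p`. -/
theorem rpow_mul_exp_neg_le {p c s : ℝ} (hp : 0 < p) (hc : 0 < c) (hs : 0 ≤ s) :
    s ^ p * Real.exp (-c * s) ≤ (p / c) ^ p := by
  have h1 : c / p * s ≤ Real.exp (c / p * s) := by linarith [Real.add_one_le_exp (c / p * s)]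
  have h2 : (c / p * s) ^ p ≤ Real.exp (c * s) := by
    calc _ ≤ Real.exp (c / p * s) ^ p := by gcongr
      _ = _ := by rw [← Real.exp_mul]; congr 1; field_simp
  have h3 : s ^ p = (p / c) ^ p * (c / p * s) ^ p := by
    rw [← Real.mul_rpow (by positivity) (by positivity)]
    congr 1; field_simp
  rw [h3, mul_assoc]
  refine mul_le_of_le_one_right (by positivity) ?_
  rw [neg_mul, Real.exp_neg, ← div_eq_mul_inv, div_le_one (Real.exp_pos _)]
  exact h2

/-- Split at the natural scale `t = d²`. Below it the exponential beats `t^(-p)` and the integrand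
is at most a constant times `(d²)^(-p)`; above it the exponential is dropped and the tail converges
because `p > 1`. -/
theorem lintegral_rpow_mul_exp_neg_div_le {p c d : ℝ} (hp : 1 < p) (hc : 0 < c) (hd : 0 < d) :
    ∫⁻ t in Set.Ioi (0 : ℝ), ENNReal.ofReal (t ^ (-p) * Real.exp (-c * d ^ 2 / t)) ≤
      ENNReal.ofReal (((p / c) ^ p + (p - 1)⁻¹) * (d ^ 2) ^ (1 - p)) := by
  have hp0 : 0 < p := by linarith
  have hD : 0 < d ^ 2 := by positivity
  rw [← Set.Ioc_union_Ioi_eq_Ioi hD.le]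
  refine (lintegral_union_le _ _ _).trans ?_
  rw [add_mul, ENNReal.ofReal_add (by positivity)
    (mul_nonneg (inv_nonneg.mpr (by linarith)) (by positivity))]
  refine add_le_add ?_ ?_
  · calc _ ≤ ∫⁻ t in Set.Ioc 0 (d ^ 2), ENNReal.ofReal ((p / c) ^ p * (d ^ 2) ^ (-p)) := by
          refine setLIntegral_mono (by fun_prop) fun t ht => ENNReal.ofReal_le_ofReal ?_
          have ht0 : 0 < t := ht.1
          have := rpow_mul_exp_neg_le hp0 hc (s := d ^ 2 / t) (by positivity)
          have e : t ^ (-p) = (d ^ 2 / t) ^ p * (d ^ 2) ^ (-p) := by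
            rw [Real.div_rpow hD.le ht0.le, Real.rpow_neg hD.le, Real.rpow_neg ht0.le]
            have := (Real.rpow_pos_of_pos hD p).ne'
            field_simp
          calc _ = ((d ^ 2 / t) ^ p * Real.exp (-c * (d ^ 2 / t))) * (d ^ 2) ^ (-p) := by
                rw [e]
                have : -c * d ^ 2 / t = -c * (d ^ 2 / t) := by ring
                rw [this]; ring
            _ ≤ _ := by gcongr
      _ = _ := by
          rw [setLIntegral_const, Real.volume_Ioc, ← ENNReal.ofReal_mul (by positivity)]
          congr 1
          rw [sub_zero, mul_assoc, ← Real.rpow_add_one hD.ne']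
          congr 2
          ring
  · calc _ ≤ ∫⁻ t in Set.Ioi (d ^ 2), ENNReal.ofReal (t ^ (-p)) := by
          refine setLIntegral_mono (by fun_prop) fun t ht => ENNReal.ofReal_le_ofReal ?_
          have ht0 : 0 < t := hD.trans ht
          refine mul_le_of_le_one_right (by positivity) (Real.exp_le_one_iff.mpr ?_)
          rw [neg_mul, neg_div]
          have : 0 ≤ c * d ^ 2 / t := by positivity
          linarith
      _ = ENNReal.ofReal (∫ t in Set.Ioi (d ^ 2), t ^ (-p)) := by
          rw [ofReal_integral_eq_lintegral_ofReal
            (integrableOn_Ioi_rpow_of_lt (by linarith) hD)]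
          exact (ae_restrict_mem measurableSet_Ioi).mono fun t ht =>
            Real.rpow_nonneg (hD.trans ht).le _
      _ = _ := by
          rw [integral_Ioi_rpow_of_lt (by linarith) hD]
          congr 1
          have : p - 1 ≠ 0 := by linarith
          have h2 : -p + 1 = -(p - 1) := by ring
          rw [h2, neg_div_neg_eq, ← h2]
          rw [show -p + 1 = 1 - p by ring]
          ring

theorem integrable_gaussKernel {t : ℝ} (ht : 0 < t) {f : RSpace n → CSpace n} (hf : Integrable f)
    (x : RSpace n) : Integrable fun y =>
      inner ℂ (complexify (gaussFactor n t (x - y) • (x - y))) (f y) := by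
  refine (hf.norm.const_mul (t⁻¹ ^ ((n : ℝ) / 2) * t⁻¹ * (1 + t / Real.pi))).mono' ?_
    (ae_of_all _ fun y => ?_)
  · refine AEStronglyMeasurable.inner (Continuous.aestronglyMeasurable ?_) hf.1
    have := continuous_gaussFactor (n := n) t
    exact continuous_complexify.comp (by fun_prop)
  · refine (norm_inner_le_norm _ _).trans ?_
    rw [norm_complexify]
    gcongr
    exact norm_gaussFactor_smul_le ht _

theorem enorm_gaussMultiplier_sub_le {t : ℝ} (ht : 0 < t) {f : RSpace n → CSpace n}
    (hf : Integrable f) {x₀ x x' : RSpace n} {r : ℝ}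
    (hx : x ∈ Metric.ball x₀ r) (hx' : x' ∈ Metric.ball x₀ r)
    (hf0 : ∀ y ∈ Metric.ball x₀ (2 * r), f y = 0) :
    ‖gaussMultiplier t f x - gaussMultiplier t f x'‖ₑ ≤
      ∫⁻ y, ENNReal.ofReal (t⁻¹ ^ ((n : ℝ) / 2) * t⁻¹ *
        (4 * Real.exp (-(Real.pi / 8) * dist y x₀ ^ 2 / t) * (2 * r))) * ‖f y‖ₑ := by
  rw [gaussMultiplier_eq ht hf, gaussMultiplier_eq ht hf, integral_const_mul, integral_const_mul,
    ← mul_sub, ← integral_sub (integrable_gaussKernel ht hf x) (integrable_gaussKernel ht hf x'),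
    enorm_mul]
  have : ‖Complex.I‖ₑ = 1 := by rw [← ofReal_norm]; simp
  rw [this, one_mul]
  refine (enorm_integral_le_lintegral_enorm _).trans (lintegral_mono fun y => ?_)
  by_cases hy : y ∈ Metric.ball x₀ (2 * r)
  · simp [hf0 y hy]
  simp only
  rw [← inner_sub_left, ← complexify_sub, ← ofReal_norm, ← ofReal_norm,
    ← ENNReal.ofReal_mul' (norm_nonneg _)]
  refine ENNReal.ofReal_le_ofReal ((norm_inner_le_norm _ _).trans ?_)
  rw [norm_complexify]
  gcongr
  rw [Metric.mem_ball, not_lt] at hy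
  -- By convexity the segment stays within `r` of `x₀`, and `r ≤ dist y x₀ / 2` because `y` lies
  -- outside the doubled ball.
  have hseg : ∀ s ∈ Set.Icc (0 : ℝ) 1,
      dist y x₀ / 2 ≤ ‖(x' - y) + s • ((x - y) - (x' - y))‖ := fun s hs => by
    have hmem : x' + s • (x - x') ∈ Metric.ball x₀ r :=
      (convex_ball x₀ r).add_smul_sub_mem hx' hx hs
    have e : (x' - y) + s • ((x - y) - (x' - y)) = (x' + s • (x - x')) - y := by
      rw [sub_sub_sub_cancel_right]; abel
    rw [e, ← dist_eq_norm]
    have := dist_triangle_left y x₀ (x' + s • (x - x'))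
    rw [Metric.mem_ball] at hmem
    linarith
  refine (norm_gaussFactor_smul_sub_le ht dist_nonneg hseg).trans ?_
  gcongr
  rw [sub_sub_sub_cancel_right, ← dist_eq_norm]
  have := dist_triangle_right x x' x₀
  rw [Metric.mem_ball] at hx hx'
  linarith

/-- The regularised Riesz transforms of a function that vanishes on `2B` oscillate little on `B`,
uniformly in the regularisation. -/
theorem exists_enorm_fourierInv_truncSymbol_sub_le (n : ℕ) : ∃ M : ℝ, 0 ≤ M ∧
    ∀ (a b : ℝ), 0 < a → ∀ (f : RSpace n → CSpace n), Integrable f →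
      ∀ (x₀ x x' : RSpace n) (r : ℝ), 0 < r → x ∈ Metric.ball x₀ r → x' ∈ Metric.ball x₀ r →
        (∀ y ∈ Metric.ball x₀ (2 * r), f y = 0) →
        ‖𝓕⁻ (fun ξ => inner ℂ (truncSymbol a b ξ) (𝓕 f ξ)) x -
          𝓕⁻ (fun ξ => inner ℂ (truncSymbol a b ξ) (𝓕 f ξ)) x'‖ₑ ≤
        ∫⁻ y, ENNReal.ofReal (M * (r * (dist y x₀ ^ (n + 1))⁻¹)) * ‖f y‖ₑ := by
  -- `p = 1/2 + n/2 + 1` collects the weight `t^(-1/2)` and the kernel factor `t^(-n/2-1)`; then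
  -- `(d²)^(1-p) = d^(-(n+1))`.
  set p : ℝ := ((n : ℝ) + 3) / 2 with hp
  have hp1 : 1 < p := by rw [hp]; linarith [(Nat.cast_nonneg n : (0 : ℝ) ≤ n)]
  have hp1' : 0 ≤ (p - 1)⁻¹ := inv_nonneg.mpr (by linarith)
  have hp0 : 0 < p := by linarith
  have hpi : 0 < Real.pi / 8 := by positivity
  -- The 8 is the Lipschitz factor 4 times the 2 in `‖x - x'‖ ≤ 2r`; the rest comes from the
  -- integral in `t`.
  refine ⟨8 * ((p / (Real.pi / 8)) ^ p + (p - 1)⁻¹), by positivity, ?_⟩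
  intro a b ha f hf x₀ x x' r hr hx hx' hf0
  rw [fourierInv_inner_truncSymbol ha hf, fourierInv_inner_truncSymbol ha hf,
    ← integral_sub (integrableOn_gaussMultiplier ha hf x) (integrableOn_gaussMultiplier ha hf x')]
  simp only [← mul_sub]
  calc _ ≤ ∫⁻ t in Set.Ioc a b, ∫⁻ y, ENNReal.ofReal
        (8 * r * (t ^ (-p) * Real.exp (-(Real.pi / 8) * dist y x₀ ^ 2 / t))) * ‖f y‖ₑ := by
        refine (enorm_integral_le_lintegral_enorm _).trans
          (setLIntegral_mono' measurableSet_Ioc fun t ht => ?_)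
        have ht0 : 0 < t := ha.trans ht.1
        rw [enorm_mul]
        have e1 : ‖((t ^ (-(1 / 2) : ℝ) : ℝ) : ℂ)‖ₑ = ENNReal.ofReal (t ^ (-(1 / 2) : ℝ)) := by
          rw [← ofReal_norm, Complex.norm_real, Real.norm_of_nonneg (by positivity)]
        rw [e1]
        refine (mul_le_mul_right (enorm_gaussMultiplier_sub_le ht0 hf hx hx' hf0) _).trans ?_
        rw [← lintegral_const_mul' _ _ ENNReal.ofReal_ne_top]
        refine le_of_eq (lintegral_congr fun y => ?_)
        rw [← mul_assoc, ← ENNReal.ofReal_mul (by positivity)]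
        congr 2
        have e2 : t ^ (-p) = t ^ (-(1 / 2) : ℝ) * (t⁻¹ ^ ((n : ℝ) / 2) * t⁻¹) := by
          rw [Real.inv_rpow ht0.le, ← Real.rpow_neg ht0.le, ← Real.rpow_neg_one t,
            ← Real.rpow_add ht0, ← Real.rpow_add ht0]
          congr 1
          rw [hp]; ring
        rw [e2]
        ring
    -- Enlarging the time window to the half-line removes the dependence on `a` and `b`.
    _ ≤ ∫⁻ t in Set.Ioi 0, ∫⁻ y, ENNReal.ofReal
        (8 * r * (t ^ (-p) * Real.exp (-(Real.pi / 8) * dist y x₀ ^ 2 / t))) * ‖f y‖ₑ :=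
        lintegral_mono_set fun t ht => ha.trans ht.1
    _ = ∫⁻ y, ∫⁻ t in Set.Ioi 0, ENNReal.ofReal
        (8 * r * (t ^ (-p) * Real.exp (-(Real.pi / 8) * dist y x₀ ^ 2 / t))) * ‖f y‖ₑ := by
        refine lintegral_lintegral_swap (AEMeasurable.fun_mul ?_ ?_)
        · refine Measurable.aemeasurable ?_
          fun_prop
        · exact hf.1.comp_snd.enorm
    _ ≤ _ := by
        refine lintegral_mono fun y => ?_
        by_cases hy : y ∈ Metric.ball x₀ (2 * r)
        · simp [hf0 y hy]
        rw [Metric.mem_ball, not_lt] at hy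
        have hd : 0 < dist y x₀ := by linarith
        simp only
        rw [lintegral_mul_const' _ _ (by simp)]
        gcongr
        simp only [ENNReal.ofReal_mul (show 0 ≤ 8 * r by positivity)]
        rw [lintegral_const_mul' _ _ ENNReal.ofReal_ne_top]
        refine (mul_le_mul_right (lintegral_rpow_mul_exp_neg_div_le hp1 hpi hd) _).trans ?_
        rw [← ENNReal.ofReal_mul (by positivity)]
        refine le_of_eq ?_
        congr 1
        have e : (dist y x₀ ^ 2) ^ (1 - p) = (dist y x₀ ^ (n + 1))⁻¹ := by
          rw [← Real.rpow_natCast, ← Real.rpow_natCast, ← Real.rpow_mul hd.le,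
            ← Real.rpow_neg hd.le]
          congr 1
          rw [hp]; push_cast; ring
        rw [e]
        ring

/-! ### Removing the regularisation -/

theorem integrable_inner_truncSymbol {a b : ℝ} (ha : 0 < a) {f : RSpace n → CSpace n}
    (hf : Integrable f) : Integrable fun ξ => inner ℂ (truncSymbol a b ξ) (𝓕 f ξ) := by
  -- At the base point 0 the modulation disappears and integration in `t` returns the truncated
  -- symbol.
  refine (integrable_prod_gaussMultiplier (b := b) ha hf 0).integral_prod_right.congr
    (ae_of_all _ fun ξ => ?_)
  simp only [inner_truncSymbol]
  rw [← integral_complex_ofReal, ← integral_mul_const]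
  refine integral_congr_ae (ae_of_all _ fun t => ?_)
  simp only [modGauss, inner_zero_left]
  push_cast
  simp
  ring

theorem ae_eq_fourierInv_inner_truncSymbol {a b : ℝ} (ha : 0 < a) {f : RSpace n → CSpace n}
    (h1 : Integrable f) (h2 : MemLp f 2) {g : L2 n ℂ}
    (hg : IsMultiplierImage (truncSymbol a b) (h2.toLp f) g) :
    ⇑g =ᵐ[volume] 𝓕⁻ fun ξ => inner ℂ (truncSymbol a b ξ) (𝓕 f ξ) := by
  have e : ⇑(𝓕 g : L2 n ℂ) =ᵐ[volume] fun ξ => inner ℂ (truncSymbol a b ξ) (𝓕 f ξ) := by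
    filter_upwards [hg, fourier_toLp_ae_eq h1 h2] with ξ a b
    rw [a, b]
  have hm : MemLp (fun ξ => inner ℂ (truncSymbol a b ξ) (𝓕 f ξ)) 2 :=
    (Lp.memLp (𝓕 g : L2 n ℂ)).ae_eq e
  have e2 : (𝓕 g : L2 n ℂ) = hm.toLp _ := Lp.ext (e.trans hm.coeFn_toLp.symm)
  have e3 : g = 𝓕⁻ (hm.toLp _ : L2 n ℂ) := by rw [← e2]; simp
  rw [e3]
  exact fourierInv_toLp_ae_eq (integrable_inner_truncSymbol ha h1) hm

/-- The Riesz transform of a function that vanishes on `2B` oscillates little on `B`. -/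
theorem exists_norm_sub_le_of_isMultiplierImage (n : ℕ) : ∃ M : ℝ, 0 ≤ M ∧
    ∀ (f : RSpace n → CSpace n) (hf : MemLp f 2) (x₀ : RSpace n) (r : ℝ), 0 < r →
      (∀ y ∈ Metric.ball x₀ (2 * r), f y = 0) →
      ∀ h : L2 n ℂ, IsMultiplierImage rieszSymbol (hf.toLp f) h → ∀ A : ℝ, 0 ≤ A →
        ∫⁻ y, ENNReal.ofReal (M * (r * (dist y x₀ ^ (n + 1))⁻¹)) * ‖f y‖ₑ ≤ ENNReal.ofReal A →
        ∃ S : Set (RSpace n), (∀ᵐ x, x ∈ S) ∧ ∀ x ∈ S, ∀ x' ∈ S,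
          x ∈ Metric.ball x₀ r → x' ∈ Metric.ball x₀ r → ‖h x - h x'‖ ≤ A := by
  obtain ⟨M, hM0, hM⟩ := exists_enorm_fourierInv_truncSymbol_sub_le n
  refine ⟨M, hM0, fun f hf x₀ r hr hf0 h hh A hA hle => ?_⟩
  -- Cutting off to large balls places `f` in L¹ ∩ L², where the integral formulas hold; the cutoff
  -- and the truncation of the symbol are removed together.
  let fs : ℕ → RSpace n → CSpace n := fun k => (Metric.ball x₀ k).indicator f
  have hfs2 : ∀ k, MemLp (fs k) 2 := fun k => hf.indicator measurableSet_ball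
  have hfs1 : ∀ k, Integrable (fs k) := fun k => by
    rw [integrable_indicator_iff measurableSet_ball]
    have : IsFiniteMeasure (volume.restrict (Metric.ball x₀ (k : ℝ))) :=
      ⟨by simpa using measure_ball_lt_top⟩
    exact (hf.restrict _).integrable (by norm_num)
  have hlim : Tendsto (fun k => (hfs2 k).toLp (fs k)) atTop (𝓝 (hf.toLp f)) := by
    rw [Lp.tendsto_Lp_iff_tendsto_eLpNorm'']
    refine tendsto_eLpNorm_two_of_dominated (bound := fun x => ‖f x‖)
      (fun k => ((hfs2 k).sub hf).1) hf.norm (fun k => ae_of_all _ fun x => ?_)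
      (ae_of_all _ fun x => ?_)
    · simp only [fs, Pi.sub_apply]
      by_cases hx : x ∈ Metric.ball x₀ (k : ℝ) <;> simp [hx]
    · refine tendsto_const_nhds.congr' ?_
      obtain ⟨N, hN⟩ := exists_nat_gt (dist x x₀)
      filter_upwards [eventually_ge_atTop N] with k hk
      have hx : x ∈ Metric.ball x₀ (k : ℝ) := by
        rw [Metric.mem_ball]
        exact hN.trans_le (by exact_mod_cast hk)
      simp [fs, hx]
  let σs : ℕ → RSpace n → CSpace n := fun k => truncSymbol ((k + 1 : ℝ)⁻¹) (k + 1)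
  have hσs : ∀ k, AEStronglyMeasurable (σs k) :=
    fun k => (measurable_truncSymbol _ _).aestronglyMeasurable
  have hσs1 : ∀ k ξ, ‖σs k ξ‖ ≤ 1 := fun k ξ => norm_truncSymbol_le (by positivity) ξ
  choose gs hgs using fun k => exists_isMultiplierImage (hσs k) (hσs1 k) ((hfs2 k).toLp (fs k))
  have hconv := tendsto_of_isMultiplierImage hσs measurable_rieszSymbol.aestronglyMeasurable hσs1
    norm_rieszSymbol_le tendsto_truncSymbol hlim hgs hh
  obtain ⟨ns, -, hns⟩ := (tendstoInMeasure_of_tendsto_Lp hconv).exists_seq_tendsto_ae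
  have hae : ∀ᵐ x, ∀ k, gs k x = 𝓕⁻ (fun ξ => inner ℂ (σs k ξ) (𝓕 (fs k) ξ)) x :=
    ae_all_iff.mpr fun k =>
      ae_eq_fourierInv_inner_truncSymbol (by positivity) (hfs1 k) (hfs2 k) (hgs k)
  -- Both conditions concern a single point, so the bound holds for every pair of points of one set
  -- of full measure, with no exceptional set of pairs.
  refine ⟨{x | Tendsto (fun i => gs (ns i) x) atTop (𝓝 (h x)) ∧
    ∀ k, gs k x = 𝓕⁻ (fun ξ => inner ℂ (σs k ξ) (𝓕 (fs k) ξ)) x}, hns.and hae, ?_⟩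
  rintro x ⟨hx1, hx2⟩ x' ⟨hx1', hx2'⟩ hx hx'
  refine le_of_tendsto (hx1.sub hx1').norm (Eventually.of_forall fun i => ?_)
  rw [hx2, hx2']
  have hzero : ∀ y ∈ Metric.ball x₀ (2 * r), fs (ns i) y = 0 := fun y hy => by
    simp only [fs, Set.indicator_apply_eq_zero]
    exact fun _ => hf0 y hy
  have := hM ((ns i + 1 : ℝ)⁻¹) (ns i + 1) (by positivity) (fs (ns i)) (hfs1 _) x₀ x x' r hr hx hx'
    hzero
  rw [← ENNReal.ofReal_le_ofReal_iff hA, ofReal_norm]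
  refine this.trans (le_trans (lintegral_mono fun y => ?_) hle)
  gcongr
  exact enorm_indicator_le_enorm_self _ _

/-! ### Averages over balls and the dyadic series -/

theorem volume_real_ball (x : RSpace n) {R : ℝ} (hR : 0 < R) :
    volume.real (Metric.ball x R) = R ^ n * volume.real (Metric.ball (0 : RSpace n) 1) := by
  rw [measureReal_def, Measure.addHaar_ball_of_pos _ _ hR, ENNReal.toReal_mul,
    ENNReal.toReal_ofReal (by positivity), finrank_euclideanSpace_fin, measureReal_def]

theorem volume_real_ball_pos (x : RSpace n) {R : ℝ} (hR : 0 < R) :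
    0 < volume.real (Metric.ball x R) :=
  ENNReal.toReal_pos (Metric.measure_ball_pos _ _ hR).ne' measure_ball_lt_top.ne

section Averages

variable {V : Type*} [NormedAddCommGroup V] {w : RSpace n → V}

theorem integrableOn_norm_ball (hw : MemLp w 2) (x : RSpace n) (R : ℝ) :
    IntegrableOn (fun y => ‖w y‖) (Metric.ball x R) := by
  have : IsFiniteMeasure (volume.restrict (Metric.ball x R)) :=
    ⟨by simpa using measure_ball_lt_top⟩
  exact ((hw.restrict _).integrable (by norm_num)).norm

theorem average_norm_nonneg (x : RSpace n) (R : ℝ) : 0 ≤ ⨍ y in Metric.ball x R, ‖w y‖ := by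
  rw [setAverage_eq]
  exact smul_nonneg (by positivity) (integral_nonneg fun _ => norm_nonneg _)

/-- From `s ≤ 1 + s²`. Uniformity in `R ≥ r` is all that summability of the dyadic series needs. -/
theorem average_norm_le (hw : MemLp w 2) (x : RSpace n) {r R : ℝ} (hr : 0 < r) (hrR : r ≤ R) :
    ⨍ y in Metric.ball x R, ‖w y‖ ≤ 1 + (volume.real (Metric.ball x r))⁻¹ * ∫ y, ‖w y‖ ^ 2 := by
  have hR : 0 < R := hr.trans_le hrR
  have hw2 : Integrable fun y => ‖w y‖ ^ 2 := (memLp_two_iff_integrable_sq_norm hw.1).mp hw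
  have h1 : ∫ y in Metric.ball x R, ‖w y‖ ≤
      volume.real (Metric.ball x R) + ∫ y, ‖w y‖ ^ 2 := by
    calc _ ≤ ∫ y in Metric.ball x R, (1 + ‖w y‖ ^ 2) := by
          refine integral_mono (integrableOn_norm_ball hw x R) ?_ fun y => ?_
          · exact (integrableOn_const measure_ball_lt_top.ne).add hw2.integrableOn
          · simp only
            nlinarith [sq_nonneg (‖w y‖ - 1)]
      _ = volume.real (Metric.ball x R) + ∫ y in Metric.ball x R, ‖w y‖ ^ 2 := by
          have hc : Integrable (fun _ => (1 : ℝ)) (volume.restrict (Metric.ball x R)) :=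
            integrableOn_const measure_ball_lt_top.ne
          rw [integral_add hc hw2.integrableOn]
          simp
      _ ≤ _ := by
          refine add_le_add le_rfl ?_
          exact setIntegral_le_integral hw2 (ae_of_all _ fun _ => sq_nonneg _)
  have hvR := volume_real_ball_pos x hR
  have hvr := volume_real_ball_pos x hr
  have hle : volume.real (Metric.ball x r) ≤ volume.real (Metric.ball x R) :=
    measureReal_mono (Metric.ball_subset_ball hrR) measure_ball_lt_top.ne
  have hI : 0 ≤ ∫ y, ‖w y‖ ^ 2 := integral_nonneg fun _ => by positivity
  rw [setAverage_eq, smul_eq_mul]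
  calc _ ≤ (volume.real (Metric.ball x R))⁻¹ *
        (volume.real (Metric.ball x R) + ∫ y, ‖w y‖ ^ 2) := by gcongr
    _ = 1 + (volume.real (Metric.ball x R))⁻¹ * ∫ y, ‖w y‖ ^ 2 := by
        rw [mul_add, inv_mul_cancel₀ hvR.ne']
    _ ≤ _ := by gcongr

theorem summable_dyadic_average (hw : MemLp w 2) (x : RSpace n) {r : ℝ} (hr : 0 < r) :
    Summable fun k : ℕ => (2 : ℝ)⁻¹ ^ (k + 1) * ⨍ y in Metric.ball x (2 ^ (k + 1) * r), ‖w y‖ := by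
  have hg : Summable fun k : ℕ => (2 : ℝ)⁻¹ ^ (k + 1) :=
    (summable_nat_add_iff 1).mpr (summable_geometric_of_lt_one (by norm_num) (by norm_num))
  refine Summable.of_nonneg_of_le
    (fun k => mul_nonneg (by positivity) (average_norm_nonneg _ _)) (fun k => ?_)
    (hg.mul_right (1 + (volume.real (Metric.ball x r))⁻¹ * ∫ y, ‖w y‖ ^ 2))
  gcongr
  refine average_norm_le hw x hr (le_mul_of_one_le_left hr.le (one_le_pow₀ (by norm_num)))

theorem setLIntegral_enorm_ball (hw : MemLp w 2) (x : RSpace n) {R : ℝ} (hR : 0 < R) :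
    ∫⁻ y in Metric.ball x R, ‖w y‖ₑ =
      ENNReal.ofReal (volume.real (Metric.ball x R) * ⨍ y in Metric.ball x R, ‖w y‖) := by
  rw [setAverage_eq, smul_eq_mul, mul_inv_cancel_left₀ (volume_real_ball_pos x hR).ne',
    ofReal_integral_eq_lintegral_ofReal (integrableOn_norm_ball hw x R)
      (ae_of_all _ fun _ => norm_nonneg _)]
  simp only [ofReal_norm]

/-- On the annulus `2^(k+1) r ≤ dist y x < 2^(k+2) r` the weight is at most `M r (2^(k+1)
r)^(-(n+1))`, while the enclosing ball has volume `κ (2^(k+2) r)^n`. The product is `M κ 2^(n+1) ·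
2^(-(k+2))`, the dyadic weight of that ball. -/
theorem lintegral_dyadic_le (hw : MemLp w 2) (x : RSpace n) {r M : ℝ} (hr : 0 < r)
    (hM : 0 ≤ M) :
    ∫⁻ y, ENNReal.ofReal (M * (r * (dist y x ^ (n + 1))⁻¹)) *
        ‖(Metric.ball x (2 * r))ᶜ.indicator w y‖ₑ ≤
      ENNReal.ofReal (M * volume.real (Metric.ball (0 : RSpace n) 1) * 2 ^ (n + 1) *
        ∑' k : ℕ, (2 : ℝ)⁻¹ ^ (k + 1) * ⨍ y in Metric.ball x (2 ^ (k + 1) * r), ‖w y‖) := by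
  set κ := volume.real (Metric.ball (0 : RSpace n) 1) with hκ
  set a : ℕ → ℝ := fun k => (2 : ℝ)⁻¹ ^ (k + 1) * ⨍ y in Metric.ball x (2 ^ (k + 1) * r), ‖w y‖
    with ha
  have ha0 : ∀ k, 0 ≤ a k := fun k => mul_nonneg (by positivity) (average_norm_nonneg _ _)
  have hsum : Summable a := summable_dyadic_average hw x hr
  have hκ0 : 0 ≤ κ := measureReal_nonneg
  calc _ ≤ ∫⁻ y, ∑' k : ℕ, (Metric.ball x (2 ^ (k + 1 + 1) * r)).indicator
        (fun y => ENNReal.ofReal (M * (r * ((2 ^ (k + 1) * r) ^ (n + 1))⁻¹)) * ‖w y‖ₑ) y := by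
        refine lintegral_mono fun y => ?_
        by_cases hy : y ∈ Metric.ball x (2 * r)
        · simp [hy]
        have hy' : 2 * r ≤ dist y x := by simpa using hy
        obtain ⟨k, hk1, hk2⟩ := exists_nat_pow_near (x := dist y x / (2 * r)) (y := (2 : ℝ))
          (by rwa [one_le_div (by positivity)]) (by norm_num)
        rw [le_div_iff₀ (by positivity)] at hk1
        rw [div_lt_iff₀ (by positivity)] at hk2
        refine le_trans ?_ (ENNReal.le_tsum k)
        have hmem : y ∈ Metric.ball x (2 ^ (k + 1 + 1) * r) := by
          rw [Metric.mem_ball]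
          calc _ < _ := hk2
            _ = _ := by ring
        have hmem' : y ∈ (Metric.ball x (2 * r))ᶜ := hy
        rw [Set.indicator_of_mem hmem, Set.indicator_of_mem hmem']
        gcongr
        calc _ = 2 ^ k * (2 * r) := by ring
          _ ≤ _ := hk1
    _ = ∑' k : ℕ, ∫⁻ y, (Metric.ball x (2 ^ (k + 1 + 1) * r)).indicator
        (fun y => ENNReal.ofReal (M * (r * ((2 ^ (k + 1) * r) ^ (n + 1))⁻¹)) * ‖w y‖ₑ) y :=
        lintegral_tsum fun k => (hw.1.enorm.const_mul _).indicator measurableSet_ball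
    _ = ∑' k : ℕ, ENNReal.ofReal (M * κ * 2 ^ (n + 1) * a (k + 1)) := by
        refine tsum_congr fun k => ?_
        have hR : 0 < 2 ^ (k + 1 + 1) * r := by positivity
        rw [lintegral_indicator measurableSet_ball, lintegral_const_mul' _ _ ENNReal.ofReal_ne_top,
          setLIntegral_enorm_ball hw x hR, ← ENNReal.ofReal_mul (by positivity),
          volume_real_ball x hR, ← hκ]
        congr 1
        simp only [ha]
        have hm : (2 : ℝ) ^ (k + 1) ≠ 0 := by positivity
        generalize (⨍ y in Metric.ball x (2 ^ (k + 1 + 1) * r), ‖w y‖) = I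
        rw [inv_pow, pow_succ (2 : ℝ) (k + 1)]
        generalize (2 : ℝ) ^ (k + 1) = m at hm
        field_simp
        ring
    _ = ENNReal.ofReal (∑' k : ℕ, M * κ * 2 ^ (n + 1) * a (k + 1)) := by
        rw [ENNReal.ofReal_tsum_of_nonneg]
        · exact fun k => mul_nonneg (by positivity) (ha0 _)
        · exact ((summable_nat_add_iff 1).mpr hsum).mul_left _
    -- The enclosing balls start at `4r`; the nonnegative term of the ball of radius `2r` is added
    -- to complete the series.
    _ ≤ _ := by
        refine ENNReal.ofReal_le_ofReal ?_
        rw [tsum_mul_left]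
        refine mul_le_mul_of_nonneg_left ?_ (by positivity)
        change _ ≤ ∑' k, a k
        have := hsum.sum_add_tsum_nat_add 1
        rw [Finset.sum_range_one] at this
        linarith [ha0 0]

end Averages

/-! ### From small oscillation to an L² bound -/

/-- Averaging the oscillation bound in `x'` gives `‖g‖ ≤ ‖l‖ + (G + L + A)` almost everywhere, with
`G`, `L` the means of `‖g‖`, `‖l‖`. Squaring, integrating and using `L ≤ √Q` finishes. -/
theorem rpow_half_integral_sq_le {Ω : Type*} {m : MeasurableSpace Ω} {ν : Measure Ω}
    [IsProbabilityMeasure ν] {g l : Ω → ℂ} (hg : MemLp g 2 ν) (hl : MemLp l 2 ν) {A : ℝ}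
    (hA : 0 ≤ A) {S : Set Ω} (hS : ∀ᵐ x ∂ν, x ∈ S)
    (h : ∀ x ∈ S, ∀ x' ∈ S, ‖(g x - l x) - (g x' - l x')‖ ≤ A) :
    (∫ x, ‖g x‖ ^ 2 ∂ν) ^ (1 / 2 : ℝ) ≤
      2 * (2 * (∫ x, ‖l x‖ ^ 2 ∂ν) ^ (1 / 2 : ℝ) + ∫ x, ‖g x‖ ∂ν + A) := by
  have hg1 : Integrable (fun x => ‖g x‖) ν := (hg.integrable (by norm_num)).norm
  have hl1 : Integrable (fun x => ‖l x‖) ν := (hl.integrable (by norm_num)).norm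
  have hg2 : Integrable (fun x => ‖g x‖ ^ 2) ν := (memLp_two_iff_integrable_sq_norm hg.1).mp hg
  have hl2 : Integrable (fun x => ‖l x‖ ^ 2) ν := (memLp_two_iff_integrable_sq_norm hl.1).mp hl
  rw [← Real.sqrt_eq_rpow, ← Real.sqrt_eq_rpow]
  set G := ∫ x, ‖g x‖ ∂ν
  set L := ∫ x, ‖l x‖ ∂ν
  set Q := ∫ x, ‖l x‖ ^ 2 ∂ν
  have hG : 0 ≤ G := integral_nonneg fun _ => norm_nonneg _
  have hL : 0 ≤ L := integral_nonneg fun _ => norm_nonneg _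
  have hQ : 0 ≤ Q := integral_nonneg fun _ => sq_nonneg _
  have hLQ : L ≤ √Q := by
    refine Real.le_sqrt_of_sq_le ?_
    -- Nonnegativity of the variance of `‖l‖`.
    have h0 : 0 ≤ ∫ x, (‖l x‖ ^ 2 - 2 * L * ‖l x‖ + L ^ 2) ∂ν :=
      integral_nonneg fun x => by
        have := sq_nonneg (‖l x‖ - L)
        simp only [Pi.zero_apply]
        linarith
    have h1 : Integrable (fun x => ‖l x‖ ^ 2 - 2 * L * ‖l x‖) ν := hl2.sub (hl1.const_mul _)
    rw [integral_add h1 (integrable_const _), integral_sub hl2 (hl1.const_mul _),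
      integral_const_mul] at h0
    simp only [integral_const, probReal_univ, one_smul] at h0
    change 0 ≤ Q - 2 * L * L + L ^ 2 at h0
    linarith
  have hpt : ∀ᵐ x ∂ν, ‖g x‖ ≤ ‖l x‖ + (G + L + A) := by
    filter_upwards [hS] with x hx
    have h1 : ∫ _, (‖g x‖ - ‖l x‖ - A) ∂ν ≤ ∫ x', (‖g x'‖ + ‖l x'‖) ∂ν := by
      refine integral_mono_ae (integrable_const _) (hg1.add hl1) ?_
      filter_upwards [hS] with x' hx'
      have e : g x = l x + ((g x - l x) - (g x' - l x')) + (g x' - l x') := by ring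
      have h2 : ‖g x‖ ≤ ‖l x‖ + ‖(g x - l x) - (g x' - l x')‖ + ‖g x' - l x'‖ := by
        conv_lhs => rw [e]
        exact norm_add₃_le
      have h3 := h x hx x' hx'
      have h4 := norm_sub_le (g x') (l x')
      linarith
    rw [integral_add hg1 hl1] at h1
    simp only [integral_const, probReal_univ, one_smul] at h1
    linarith
  have hint : ∫ x, ‖g x‖ ^ 2 ∂ν ≤ 2 * Q + 2 * (G + L + A) ^ 2 := by
    calc _ ≤ ∫ x, (2 * ‖l x‖ ^ 2 + 2 * (G + L + A) ^ 2) ∂ν := by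
          refine integral_mono_ae hg2 ((hl2.const_mul 2).add (integrable_const _)) ?_
          filter_upwards [hpt] with x hx
          have : ‖g x‖ ^ 2 ≤ (‖l x‖ + (G + L + A)) ^ 2 := by gcongr
          nlinarith [sq_nonneg (‖l x‖ - (G + L + A))]
      _ = _ := by
          rw [integral_add (hl2.const_mul 2) (integrable_const _), integral_const_mul]
          simp only [integral_const, probReal_univ, one_smul]
          rfl
  have hc : 0 ≤ G + L + A := by positivity
  calc √(∫ x, ‖g x‖ ^ 2 ∂ν) ≤ 2 * (√Q + (G + L + A)) := by
        refine Real.sqrt_le_iff.mpr ⟨by positivity, hint.trans ?_⟩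
        have h1 := Real.sq_sqrt hQ
        have h2 : 0 ≤ √Q * (G + L + A) := mul_nonneg (Real.sqrt_nonneg _) hc
        nlinarith [sq_nonneg (G + L + A)]
    _ ≤ _ := by linarith

/-! ### The symbols of the two fractional operators -/

theorem inner_complexify_complexify (z z' : RSpace n) :
    inner ℂ (complexify z) (complexify z') = ((inner ℝ z z' : ℝ) : ℂ) := by
  rw [inner_complexify, PiLp.inner_apply]
  push_cast
  exact Finset.sum_congr rfl fun j _ => by simp [mul_comm]

theorem gradSymbol_eq (α : ℝ) (η : RSpace n) :
    gradSymbol α η = complexify ((‖η‖ ^ (1 - α))⁻¹ • η) := by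
  ext j
  simp [gradSymbol, div_eq_inv_mul]

/-- Homogeneity of degree 0 makes the factor 2π between the two frequency conventions immaterial. -/
theorem rieszSymbol_smul {c : ℝ} (hc : 0 < c) (ξ : RSpace n) :
    rieszSymbol (c • ξ) = rieszSymbol ξ := by
  rw [rieszSymbol, rieszSymbol, norm_smul, Real.norm_of_nonneg hc.le, smul_smul, mul_inv,
    mul_right_comm, inv_mul_cancel₀ hc.ne', one_mul]

theorem inner_rieszSymbol_gradSymbol {α : ℝ} (hα : 0 < α) (η : RSpace n) :
    inner ℂ (rieszSymbol η) (gradSymbol α η) = laplaceSymbol α η := by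
  rw [gradSymbol_eq, rieszSymbol, inner_complexify_complexify, laplaceSymbol, inner_smul_left,
    inner_smul_right, real_inner_self_eq_norm_sq]
  congr 1
  -- At the origin both sides vanish, since `0 ^ α = 0` for `α > 0`.
  rcases eq_or_ne η 0 with rfl | hη
  · simp [Real.zero_rpow hα.ne']
  · have hp : 0 < ‖η‖ := norm_pos_iff.mpr hη
    rw [Real.rpow_sub hp, Real.rpow_one]
    have := (Real.rpow_pos_of_pos hp α).ne'
    simp
    field_simp

/-- The fractional Laplacian is the Riesz transform of the Riesz fractional gradient. -/
theorem isMultiplierImage_rieszSymbol {α : ℝ} (hα : 0 < α) {u g : L2 n ℂ} {w : L2 n (CSpace n)}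
    (hw : HasSymbol (gradSymbol α) u w) (hg : HasSymbol (laplaceSymbol α) u g) :
    IsMultiplierImage rieszSymbol w g := by
  filter_upwards [hw, hg] with ξ h1 h2
  rw [h2, h1, inner_smul_right, ← rieszSymbol_smul (c := 2 * Real.pi) (by positivity) ξ,
    inner_rieszSymbol_gradSymbol hα, smul_eq_mul]

/-! ### The local part and the conclusion -/

theorem L2_norm_sq_eq_integral {V : Type} [NormedAddCommGroup V] (F : L2 n V) :
    ‖F‖ ^ 2 = ∫ y, ‖F y‖ ^ 2 := by
  have h0 : 0 ≤ ∫ y, ‖F y‖ ^ 2 := integral_nonneg fun _ => sq_nonneg _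
  rw [Lp.norm_def, (Lp.memLp F).eLpNorm_eq_integral_rpow_norm (by norm_num) (by norm_num)]
  simp only [ENNReal.toReal_ofNat, Real.rpow_ofNat]
  rw [ENNReal.toReal_ofReal (by positivity), ← Real.rpow_natCast, ← Real.rpow_mul h0]
  norm_num

/-- Plancherel on the whole space; the factor `2 ^ n` is the volume ratio of the two balls. -/
theorem average_sq_le_of_isMultiplierImage {σ : RSpace n → CSpace n} (hσ : ∀ ξ, ‖σ ξ‖ ≤ 1)
    {w : L2 n (CSpace n)} {x : RSpace n} {r : ℝ} (hr : 0 < r)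
    (hw : MemLp ((Metric.ball x (2 * r)).indicator w) 2) {l : L2 n ℂ}
    (hl : IsMultiplierImage σ (hw.toLp _) l) :
    ⨍ y in Metric.ball x r, ‖l y‖ ^ 2 ≤ 2 ^ n * ⨍ y in Metric.ball x (2 * r), ‖w y‖ ^ 2 := by
  have hv := volume_real_ball_pos x hr
  have hv2 : volume.real (Metric.ball x (2 * r)) = 2 ^ n * volume.real (Metric.ball x r) := by
    rw [volume_real_ball x hr, volume_real_ball x (by positivity : 0 < 2 * r), mul_pow, mul_assoc]
  have h1 : ∫ y in Metric.ball x r, ‖l y‖ ^ 2 ≤ ∫ y in Metric.ball x (2 * r), ‖w y‖ ^ 2 := by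
    calc _ ≤ ∫ y, ‖l y‖ ^ 2 := setIntegral_le_integral
          ((memLp_two_iff_integrable_sq_norm (Lp.memLp l).1).mp (Lp.memLp l))
          (ae_of_all _ fun _ => sq_nonneg _)
      _ = ‖l‖ ^ 2 := (L2_norm_sq_eq_integral l).symm
      _ ≤ ‖hw.toLp _‖ ^ 2 := by
          have := hl.norm_le hσ
          gcongr
      _ = ∫ y, ‖(Metric.ball x (2 * r)).indicator w y‖ ^ 2 := by
          rw [L2_norm_sq_eq_integral]
          refine integral_congr_ae ?_
          filter_upwards [hw.coeFn_toLp] with y hy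
          rw [hy]
      _ = _ := by
          rw [← integral_indicator measurableSet_ball]
          refine integral_congr_ae (ae_of_all _ fun y => ?_)
          by_cases hy : y ∈ Metric.ball x (2 * r)
          · simp only [Set.indicator_of_mem hy]
          · simp [Set.indicator_of_notMem hy]
  rw [setAverage_eq, setAverage_eq, hv2, smul_eq_mul, smul_eq_mul, mul_inv, ← mul_assoc,
    mul_inv_cancel_left₀ (by positivity)]
  gcongr

theorem exists_rpow_half_average_sq_le (n : ℕ) : ∃ C : ℝ, 0 < C ∧
    ∀ (w : L2 n (CSpace n)) (g : L2 n ℂ), IsMultiplierImage rieszSymbol w g →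
      ∀ (x : RSpace n) (r : ℝ), 0 < r →
        (⨍ y in Metric.ball x r, ‖g y‖ ^ 2) ^ (1 / 2 : ℝ) ≤
          C * ((⨍ y in Metric.ball x (2 * r), ‖w y‖ ^ 2) ^ (1 / 2 : ℝ)
            + (⨍ y in Metric.ball x r, ‖g y‖)
            + ∑' k : ℕ, (2 : ℝ)⁻¹ ^ (k + 1) *
                ⨍ y in Metric.ball x (2 ^ (k + 1) * r), ‖w y‖) := by
  obtain ⟨M, hM0, hM⟩ := exists_norm_sub_le_of_isMultiplierImage n
  set κ := volume.real (Metric.ball (0 : RSpace n) 1)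
  have hκ : 0 ≤ κ := measureReal_nonneg
  set K := M * κ * 2 ^ (n + 1)
  have hK : 0 ≤ K := by positivity
  refine ⟨2 * (2 * 2 ^ n + 1 + K), by positivity, fun w g hgw x r hr => ?_⟩
  set B := Metric.ball x r
  set B₂ := Metric.ball x (2 * r)
  set T := ∑' k : ℕ, (2 : ℝ)⁻¹ ^ (k + 1) * ⨍ y in Metric.ball x (2 ^ (k + 1) * r), ‖w y‖
  have hT : 0 ≤ T := tsum_nonneg fun k => mul_nonneg (by positivity) (average_norm_nonneg _ _)
  have hw := Lp.memLp w
  have hw1 : MemLp (B₂.indicator w) 2 := hw.indicator measurableSet_ball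
  have hw2 : MemLp (B₂ᶜ.indicator w) 2 := hw.indicator measurableSet_ball.compl
  obtain ⟨l, hl⟩ := exists_isMultiplierImage measurable_rieszSymbol.aestronglyMeasurable
    norm_rieszSymbol_le (hw1.toLp _)
  have hsub : w - hw1.toLp _ = hw2.toLp _ := by
    refine Lp.ext ?_
    filter_upwards [Lp.coeFn_sub w (hw1.toLp _), hw1.coeFn_toLp, hw2.coeFn_toLp] with y h1 h2 h3
    rw [h1, h3, Pi.sub_apply, h2, sub_eq_iff_eq_add, ← Pi.add_apply,
      Set.indicator_compl_add_self]
  -- By linearity the far part is `g - l`, so no separate transform of it is constructed.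
  have hh : IsMultiplierImage rieszSymbol (hw2.toLp _) (g - l) := hsub ▸ hgw.sub hl
  obtain ⟨S, hS, hSA⟩ := hM _ hw2 x r hr (fun y hy => by simp [hy, B₂]) (g - l) hh (K * T)
    (mul_nonneg hK hT) (lintegral_dyadic_le hw x hr hM0)
  have hv0 : volume B ≠ 0 := (Metric.measure_ball_pos _ _ hr).ne'
  have hvt : volume B ≠ ⊤ := measure_ball_lt_top.ne
  -- Integrals against this normalised measure are by definition the averages over `B`, which the
  -- later `change` steps exploit.
  set ν : Measure (RSpace n) := (volume.restrict B Set.univ)⁻¹ • volume.restrict B with hν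
  have hc : (volume.restrict B Set.univ)⁻¹ ≠ ⊤ := by simpa using hv0
  have hprob : IsProbabilityMeasure ν := ⟨by
    simp [hν, ENNReal.inv_mul_cancel hv0 hvt]⟩
  have hae : ∀ᵐ y ∂ν, y ∈ B ∧ y ∈ S ∧ (g - l : L2 n ℂ) y = g y - l y := by
    refine Measure.ae_smul_measure ?_ _
    filter_upwards [ae_restrict_mem measurableSet_ball, ae_restrict_of_ae hS,
      ae_restrict_of_ae (Lp.coeFn_sub g l)] with y h1 h2 h3
    exact ⟨h1, h2, h3⟩
  have hmain := rpow_half_integral_sq_le (ν := ν) (((Lp.memLp g).restrict B).smul_measure hc)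
    (((Lp.memLp l).restrict B).smul_measure hc) (mul_nonneg hK hT) hae
    (fun y hy y' hy' => by
      rw [← hy.2.2, ← hy'.2.2]
      exact hSA y hy.2.1 y' hy'.2.1 hy.1 hy'.1)
  have hloc : (∫ y, ‖l y‖ ^ 2 ∂ν) ^ (1 / 2 : ℝ) ≤
      2 ^ n * (⨍ y in B₂, ‖w y‖ ^ 2) ^ (1 / 2 : ℝ) := by
    have h1 := average_sq_le_of_isMultiplierImage norm_rieszSymbol_le hr hw1 hl
    have h0 : 0 ≤ ⨍ y in B₂, ‖w y‖ ^ 2 := by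
      rw [setAverage_eq]
      exact smul_nonneg (by positivity) (integral_nonneg fun _ => sq_nonneg _)
    have h2 : (1 : ℝ) ≤ 2 ^ n := one_le_pow₀ (by norm_num)
    calc _ ≤ (2 ^ n * ⨍ y in B₂, ‖w y‖ ^ 2) ^ (1 / 2 : ℝ) :=
          Real.rpow_le_rpow (integral_nonneg fun _ => sq_nonneg _) h1 (by norm_num)
      _ = (2 ^ n : ℝ) ^ (1 / 2 : ℝ) * (⨍ y in B₂, ‖w y‖ ^ 2) ^ (1 / 2 : ℝ) :=
          Real.mul_rpow (by positivity) h0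
      _ ≤ _ := by
          gcongr
          calc (2 ^ n : ℝ) ^ (1 / 2 : ℝ) ≤ (2 ^ n : ℝ) ^ (1 : ℝ) :=
                Real.rpow_le_rpow_of_exponent_le h2 (by norm_num)
            _ = _ := Real.rpow_one _
  have hG : 0 ≤ ⨍ y in B, ‖g y‖ := average_norm_nonneg _ _
  have hW : 0 ≤ (⨍ y in B₂, ‖w y‖ ^ 2) ^ (1 / 2 : ℝ) := by
    refine Real.rpow_nonneg ?_ _
    rw [setAverage_eq]
    exact smul_nonneg (by positivity) (integral_nonneg fun _ => sq_nonneg _)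
  change (⨍ y in B, ‖g y‖ ^ 2) ^ (1 / 2 : ℝ) ≤ _ at hmain
  change _ ≤ 2 * (_ + (⨍ y in B, ‖g y‖) + K * T) at hmain
  set W := (⨍ y in B₂, ‖w y‖ ^ 2) ^ (1 / 2 : ℝ)
  set G := ⨍ y in B, ‖g y‖
  have hpow : (0 : ℝ) ≤ 2 ^ n := by positivity
  calc _ ≤ 2 * (2 * (2 ^ n * W) + G + K * T) := hmain.trans (by gcongr)
    _ ≤ _ := by
      nlinarith [mul_nonneg hpow hG, mul_nonneg hpow hT, mul_nonneg hK hW, mul_nonneg hK hG]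

end LocalRiesz

end

theorem mainTheorem12 (n : ℕ) (hn : 2 ≤ n) (α : ℝ) (hα : 0 < α) (hα1 : α < 1) :
    ∃ C : ℝ, 0 < C ∧
      ∀ (u : LocalRiesz.L2 n ℂ) (hu : LocalRiesz.MemH α u)
        (x : LocalRiesz.RSpace n) (r : ℝ), 0 < r →
        Summable (fun k : ℕ => (2 : ℝ)⁻¹ ^ (k + 1) *
          ⨍ y in Metric.ball x (2 ^ (k + 1) * r), ‖LocalRiesz.rieszGradient hu y‖) ∧
        (⨍ y in Metric.ball x r, ‖LocalRiesz.fracLaplacian hu hα y‖ ^ 2) ^ (1 / 2 : ℝ) ≤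
          C * ((⨍ y in Metric.ball x (2 * r), ‖LocalRiesz.rieszGradient hu y‖ ^ 2) ^ (1 / 2 : ℝ)
            + (⨍ y in Metric.ball x r, ‖LocalRiesz.fracLaplacian hu hα y‖)
            + ∑' k : ℕ, (2 : ℝ)⁻¹ ^ (k + 1) *
                ⨍ y in Metric.ball x (2 ^ (k + 1) * r), ‖LocalRiesz.rieszGradient hu y‖) := by
  obtain ⟨C, hC, h⟩ := LocalRiesz.exists_rpow_half_average_sq_le n
  refine ⟨C, hC, fun u hu x r hr => ⟨LocalRiesz.summable_dyadic_average (Lp.memLp _) x hr, ?_⟩⟩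
  exact h _ _ (LocalRiesz.isMultiplierImage_rieszSymbol hα hu.choose_spec
    (hu.exists_fracLaplacian hα).choose_spec) x r hr
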